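/- Let $n \ge 2$, $m \ge 1$, and let $$f(z,\bar z) = \sum_{|\alpha|=|\beta|=m} c_{\alpha\beta}\, z^\alpha \bar z^\beta, \qquad z \in \mathbb{C}^n,\ c_{\alpha\beta}\in\mathbb{C},$$ be a bi-homogeneous form of degree $m$ on $\mathbb{C}^n$, where $\alpha,\beta\in\mathbb{N}^n$ are multi-indices, $|\alpha| = \alpha_1+\dots+\alpha_n$, $\alpha! = \alpha_1!\cdots\alpha_n!$ and $z^\alpha = z_1^{\alpha_1}\cdots z_n^{\alpha_n}$. Suppose that $f(z,\bar z)$ is real and $f(z,\bar z) > 0$ for all $z \neq 0$. With $\|z\|^2 = \sum_{j=1}^n |z_j|^2$, put $$\lambda(f) := \min_{\|z\|=1} f(z,\bar z), \qquad \Lambda(f) := \Bigl(\sum_{|\alpha|=|\beta|=m} \frac{\alpha!\,\beta!}{(m!)^2}\,|c_{\alpha\beta}|^2\Bigr)^{1/2}.$$ Then there is a universal constant $C > 0$ (independent of $n$, $m$, $f$ and $N$) such that for every integer $N \ge 0$ with $$N \ \ge\ C\,\frac{\Lambda(f)}{\lambda(f)}\,(m+n)^3 \log^3 n$$ there are homogeneous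 polynomials $P_1,\dots,P_{d_N}$ of degree $m+N$ in $z_1,\dots,z_n$ with complex coefficients (some of which may be zero) satisfying $$\|z\|^{2N} f(z,\bar z) = \sum_{j=1}^{d_N} |P_j(z)|^2 \qquad \text{for all } z\in\mathbb{C}^n,$$ where $d_N$ is the dimension of the complex vector space of homogeneous polynomials of degree $m+N$ in $n$ variables. -/

import Mathlib

open scoped Nat ComplexOrder

noncomputable section

namespace HermitianSOS

/-- The finite set of multi-indices `α ∈ ℕⁿ` with `|α| = α₁ + ⋯ + αₙ = m`. -/
def multiIndices (n m : ℕ) : Finset (Fin n →₀ ℕ) :=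
  Finset.finsuppAntidiag Finset.univ m

theorem mem_multiIndices {n m : ℕ} {α : Fin n →₀ ℕ} :
    α ∈ multiIndices n m ↔ ∑ i, α i = m := by
  simp [multiIndices, Finset.mem_finsuppAntidiag]

/-- The monomial `z^α = z₁^α₁ ⋯ zₙ^αₙ`. -/
def monomialAt {n : ℕ} (z : EuclideanSpace ℂ (Fin n)) (α : Fin n →₀ ℕ) : ℂ :=
  ∏ i, z i ^ α i

/-- The factorial `α! = α₁! ⋯ αₙ!` of a multi-index. -/
def multiFactorial {n : ℕ} (α : Fin n →₀ ℕ) : ℕ :=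
  ∏ i, (α i)!

/-- The bi-homogeneous form `f(z, z̄) = ∑_{|α| = |β| = m} c_{αβ} z^α z̄^β` of degree `m` on `ℂⁿ`.
Only the coefficients `c α β` with `|α| = |β| = m` are used. -/
def form {n : ℕ} (m : ℕ) (c : (Fin n →₀ ℕ) → (Fin n →₀ ℕ) → ℂ)
    (z : EuclideanSpace ℂ (Fin n)) : ℂ :=
  ∑ α ∈ multiIndices n m, ∑ β ∈ multiIndices n m,
    c α β * monomialAt z α * (starRingEnd ℂ) (monomialAt z β)

/-- `λ(f)`, the minimum of the (real-valued) form `f(z, z̄)` on the unit sphere `‖z‖ = 1`;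
see `isLeast_minOnSphere`. -/
def minOnSphere {n : ℕ} (m : ℕ) (c : (Fin n →₀ ℕ) → (Fin n →₀ ℕ) → ℂ) : ℝ :=
  sInf ((fun z => (form m c z).re) '' Metric.sphere (0 : EuclideanSpace ℂ (Fin n)) 1)

/-- `Λ(f) = (∑_{|α| = |β| = m} (α! β! / m!²) |c_{αβ}|²)^{1/2}`. -/
def coeffNorm {n : ℕ} (m : ℕ) (c : (Fin n →₀ ℕ) → (Fin n →₀ ℕ) → ℂ) : ℝ :=
  Real.sqrt (∑ α ∈ multiIndices n m, ∑ β ∈ multiIndices n m,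
    ((multiFactorial α : ℝ) * (multiFactorial β : ℝ) / ((m)! : ℝ) ^ 2) * ‖c α β‖ ^ 2)

/-- The infimum defining `minOnSphere` is an attained minimum. -/
theorem isLeast_minOnSphere {n : ℕ} (hn : 0 < n) (m : ℕ)
    (c : (Fin n →₀ ℕ) → (Fin n →₀ ℕ) → ℂ) :
    IsLeast ((fun z => (form m c z).re) '' Metric.sphere (0 : EuclideanSpace ℂ (Fin n)) 1)
      (minOnSphere m c) := by
  have hne : (Metric.sphere (0 : EuclideanSpace ℂ (Fin n)) 1).Nonempty :=
    ⟨EuclideanSpace.single ⟨0, hn⟩ 1, by simp⟩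
  have hcont : Continuous (fun z : EuclideanSpace ℂ (Fin n) => (form m c z).re) := by
    unfold form monomialAt
    fun_prop
  exact ((isCompact_sphere _ _).image hcont).isLeast_sInf (hne.image _)

end HermitianSOS

end

/-!
A real-valued form `∑ H_{μν} z^μ z̄^ν` of bidegree `(k, k)` is a sum of squared moduli of homogeneous
polynomials, as many as the dimension of the space of such polynomials of degree `k`, as soon
as the Hermitian part of its coefficient matrix is positive semidefinite
(`exists_sum_norm_sq_of_fischer_re_nonneg`). For `F = ‖z‖^{2N} f` this is tested against `G = |q|²`
with `q` homogeneous of degree `m + N`, in the Fischer pairing, where multiplication by a variable is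
adjoint to differentiation in the conjugate variable. Polynomials in `z` and `z̄` are treated as
polynomials in independent variables indexed by `ι ⊕ ι`.

The central identity (`fischer_normSqPoly_pow_mul`) is
`⟨G, ‖z‖^{2N} f⟩ = N! ∫ (e^{-Δ} f) G dγ`, with `γ` the standard Gaussian measure on `ℂⁿ` and
`Δ = ∑ ∂²/∂zᵢ∂z̄ᵢ`. It expresses that the normally ordered quantization of `f` is the antinormally
ordered quantization of `e^{-Δ} f`, and follows from the commutator `[Δ, zᵢ] = ∂/∂z̄ᵢ` and Gaussian
integration by parts. Antinormal ordering is positive: it suffices that the symbol is nonnegative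
pointwise.

Since `G` is bihomogeneous, multiplying a term of the symbol by `‖z‖²` only rescales its integral, so
`Δʲ f` may be replaced by `‖z‖^{2j} Δʲ f` divided by at least `Nʲ`. The symbol then is `f` plus
corrections of the same degree (`upperSymbol`). With `Λ(f)` read as a Fischer norm, one application of
`Δ` costs a factor `√n m²` (`fischerNormSq_mixedLaplacian_pow_le`) and point evaluation costs nothing
(`norm_diagEval_sq_le`), so the corrections are bounded on the unit sphere by
`Λ(f) (exp (√n m² / N) - 1)`. This is at most `λ(f)` once `N ≥ 2 (Λ(f)/λ(f)) √n m²`, and since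
`√n m² ≤ (m + n)³` and `log n ≥ 1/2`, the constant `C = 16` is admissible.
-/

namespace HermitianSOS

open MvPolynomial Finset MeasureTheory
open scoped ComplexConjugate

variable {ι : Type*} [Fintype ι]

/-! ### The Fischer pairing, Gaussian moments and the mixed Laplacian -/

/-- `p` is bihomogeneous of bidegree `(a, b)`: degree `a` in the holomorphic variables `X (inl i)`
and degree `b` in the antiholomorphic variables `X (inr i)`. The zero polynomial has every bidegree. -/
def IsBihomogeneous (p : MvPolynomial (ι ⊕ ι) ℂ) (a b : ℕ) : Prop :=
  ∀ s, coeff s p ≠ 0 → ∑ i, s (Sum.inl i) = a ∧ ∑ i, s (Sum.inr i) = b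

/-- The mixed Laplacian `Δ = ∑ᵢ ∂²/∂zᵢ∂z̄ᵢ`, with `z̄ᵢ` encoded as the independent variable
`X (inr i)`. -/
noncomputable def mixedLaplacian : MvPolynomial (ι ⊕ ι) ℂ →ₗ[ℂ] MvPolynomial (ι ⊕ ι) ℂ :=
  ∑ i : ι, (pderiv (Sum.inr i)).toLinearMap ∘ₗ (pderiv (Sum.inl i)).toLinearMap

/-- The polynomial `∑ᵢ zᵢ z̄ᵢ`, whose restriction to the diagonal is `‖z‖²`. -/
noncomputable def normSqPoly (ι : Type*) [Fintype ι] : MvPolynomial (ι ⊕ ι) ℂ :=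
  ∑ i : ι, X (Sum.inl i) * X (Sum.inr i)

/-- The backward heat operator `e^{-Δ} = ∑ⱼ (-1)ʲ Δʲ / j!`, truncated to `j < M`. The truncation is
exact on polynomials of degree less than `M` in the `zᵢ`. -/
noncomputable def heat (M : ℕ) : MvPolynomial (ι ⊕ ι) ℂ →ₗ[ℂ] MvPolynomial (ι ⊕ ι) ℂ :=
  ∑ j ∈ range M, ((-1 : ℂ) ^ j / (j ! : ℂ)) • mixedLaplacian ^ j

/-- The linear functional with `z^α z̄^β ↦ δ_{αβ} α!`, which is integration against the Gaussian
measure `π^{-n} e^{-‖z‖²}`; see `integral_diagEval`. -/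
noncomputable def gaussMoment : MvPolynomial (ι ⊕ ι) ℂ →ₗ[ℂ] ℂ :=
  (basisMonomials (ι ⊕ ι) ℂ).constr ℂ fun s =>
    ∏ i, if s (Sum.inl i) = s (Sum.inr i) then ((s (Sum.inl i))! : ℂ) else 0

/-- The bilinear Fischer pairing of `G` with a polynomial, twisted by the exchange of `z` and `z̄`:
`z^α z̄^β` is sent to `α! β!` times the coefficient of `z^β z̄^α` in `G`. The twist makes
multiplication by `zᵢ` adjoint to `∂/∂z̄ᵢ`, as it is for `gaussMoment`. -/
noncomputable def fischer (G : MvPolynomial (ι ⊕ ι) ℂ) : MvPolynomial (ι ⊕ ι) ℂ →ₗ[ℂ] ℂ :=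
  (basisMonomials (ι ⊕ ι) ℂ).constr ℂ fun s =>
    (∏ x, ((s x)! : ℂ)) *
      coeff (s.mapDomain Sum.swap) G

theorem gaussMoment_monomial (s : ι ⊕ ι →₀ ℕ) :
    gaussMoment (monomial s 1) =
      ∏ i, if s (Sum.inl i) = s (Sum.inr i) then ((s (Sum.inl i))! : ℂ) else 0 := by
  rw [gaussMoment]
  simpa using (basisMonomials (ι ⊕ ι) ℂ).constr_basis ℂ (fun s : ι ⊕ ι →₀ ℕ =>
    ∏ i, if s (Sum.inl i) = s (Sum.inr i) then ((s (Sum.inl i))! : ℂ) else 0) s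

theorem fischer_monomial (G : MvPolynomial (ι ⊕ ι) ℂ) (s : ι ⊕ ι →₀ ℕ) :
    fischer G (monomial s 1) = (∏ x, ((s x)! : ℂ)) *
      coeff (s.mapDomain Sum.swap) G := by
  rw [fischer]
  simpa using (basisMonomials (ι ⊕ ι) ℂ).constr_basis ℂ (fun s : ι ⊕ ι →₀ ℕ =>
    (∏ x, ((s x)! : ℂ)) * coeff (s.mapDomain Sum.swap) G) s

theorem mixedLaplacian_apply (p : MvPolynomial (ι ⊕ ι) ℂ) :
    mixedLaplacian p = ∑ i, pderiv (Sum.inr i) (pderiv (Sum.inl i) p) := by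
  simp [mixedLaplacian]

theorem linearMap_ext_monomial {σ V : Type*} [AddCommGroup V] [Module ℂ V]
    {f g : MvPolynomial σ ℂ →ₗ[ℂ] V} (h : ∀ s, f (monomial s 1) = g (monomial s 1))
    (p : MvPolynomial σ ℂ) : f p = g p := by
  have : f = g := (basisMonomials σ ℂ).ext fun s => by simpa using h s
  rw [this]

theorem pderiv_comm {σ : Type*} (i j : σ) (p : MvPolynomial σ ℂ) :
    pderiv i (pderiv j p) = pderiv j (pderiv i p) := by
  classical
  ext s
  simp only [coeff_pderiv, add_right_comm s]
  by_cases h : i = j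
  · subst h; rfl
  · simp [h, Ne.symm h]; ring

/-! ### Bihomogeneous polynomials -/

namespace IsBihomogeneous

variable {p q : MvPolynomial (ι ⊕ ι) ℂ} {a b a' b' : ℕ}

theorem zero : IsBihomogeneous (0 : MvPolynomial (ι ⊕ ι) ℂ) a b := by
  intro s hs; simp at hs

theorem add (hp : IsBihomogeneous p a b) (hq : IsBihomogeneous q a b) :
    IsBihomogeneous (p + q) a b := by
  intro s hs
  by_cases h : coeff s p = 0
  · exact hq s (by simpa [h] using hs)
  · exact hp s h

theorem sum {κ : Type*} {S : Finset κ} {f : κ → MvPolynomial (ι ⊕ ι) ℂ}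
    (h : ∀ k ∈ S, IsBihomogeneous (f k) a b) : IsBihomogeneous (∑ k ∈ S, f k) a b := by
  classical
  induction S using Finset.induction_on with
  | empty => simpa using zero
  | insert k S hk ih =>
    rw [sum_insert hk]
    exact (h k (by simp)).add (ih fun k hk => h k (by simp [hk]))

theorem mul (hp : IsBihomogeneous p a b) (hq : IsBihomogeneous q a' b') :
    IsBihomogeneous (p * q) (a + a') (b + b') := by
  classical
  intro s hs
  rw [coeff_mul] at hs
  obtain ⟨⟨u, v⟩, huv, h⟩ := exists_ne_zero_of_sum_ne_zero hs
  obtain rfl : u + v = s := by simpa using huv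
  have h1 := hp u (left_ne_zero_of_mul h)
  have h2 := hq v (right_ne_zero_of_mul h)
  simp [sum_add_distrib, h1, h2]

theorem monomial (s : ι ⊕ ι →₀ ℕ) (c : ℂ) :
    IsBihomogeneous (monomial s c) (∑ i, s (Sum.inl i)) (∑ i, s (Sum.inr i)) := by
  classical
  intro t ht
  rw [coeff_monomial] at ht
  obtain rfl : s = t := by by_contra h; simp [h] at ht
  simp

theorem normSqPoly : IsBihomogeneous (normSqPoly ι) 1 1 := by
  classical
  refine sum fun i _ => ?_
  have h := (monomial (Finsupp.single (Sum.inl i) 1) 1).mul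
    (monomial (Finsupp.single (Sum.inr i : ι ⊕ ι) 1) 1)
  simpa [MvPolynomial.X, Finsupp.single_apply] using h

theorem normSqPoly_pow (N : ℕ) : IsBihomogeneous (HermitianSOS.normSqPoly ι ^ N) N N := by
  induction N with
  | zero => simpa using monomial (0 : ι ⊕ ι →₀ ℕ) 1
  | succ N ih => rw [pow_succ]; exact ih.mul normSqPoly

theorem pderiv_inl (hp : IsBihomogeneous p a b) (i : ι) :
    IsBihomogeneous (pderiv (Sum.inl i) p) (a - 1) b := by
  classical
  intro s hs
  rw [coeff_pderiv] at hs
  have h := hp _ (left_ne_zero_of_mul hs)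
  simp [sum_add_distrib, Finsupp.single_apply] at h
  omega

theorem pderiv_inr (hp : IsBihomogeneous p a b) (i : ι) :
    IsBihomogeneous (pderiv (Sum.inr i) p) a (b - 1) := by
  classical
  intro s hs
  rw [coeff_pderiv] at hs
  have h := hp _ (left_ne_zero_of_mul hs)
  simp [sum_add_distrib, Finsupp.single_apply] at h
  omega

theorem pderiv_inl_eq_zero (hp : IsBihomogeneous p 0 b) (i : ι) :
    pderiv (Sum.inl i) p = 0 := by
  classical
  ext s
  rw [coeff_zero, coeff_pderiv]
  by_contra hs
  have h := hp _ (left_ne_zero_of_mul hs)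
  simp [sum_add_distrib, Finsupp.single_apply] at h

theorem mixedLaplacian (hp : IsBihomogeneous p a b) :
    IsBihomogeneous (mixedLaplacian p) (a - 1) (b - 1) := by
  rw [mixedLaplacian_apply]
  exact sum fun i _ => (hp.pderiv_inl i).pderiv_inr i

theorem mixedLaplacian_pow (hp : IsBihomogeneous p a b) (j : ℕ) :
    IsBihomogeneous ((HermitianSOS.mixedLaplacian ^ j) p) (a - j) (b - j) := by
  induction j with
  | zero => simpa using hp
  | succ j ih =>
    rw [pow_succ', Module.End.mul_apply]
    exact ih.mixedLaplacian

theorem mixedLaplacian_pow_eq_zero (hp : IsBihomogeneous p a b) {j : ℕ} (hj : a < j) :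
    (HermitianSOS.mixedLaplacian ^ j) p = 0 := by
  induction j with
  | zero => omega
  | succ j ih =>
    rw [pow_succ', Module.End.mul_apply, mixedLaplacian_apply]
    have h := hp.mixedLaplacian_pow j
    rw [show a - j = 0 by omega] at h
    simp [h.pderiv_inl_eq_zero]

theorem sum_X_mul_pderiv_inl (hp : IsBihomogeneous p a b) :
    ∑ i, X (Sum.inl i) * pderiv (Sum.inl i) p = (a : ℂ) • p := by
  have h : IsWeightedHomogeneous (Sum.elim (fun _ => 1) (fun _ => 0) : ι ⊕ ι → ℕ) p a := by
    intro s hs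
    rw [Finsupp.weight_apply, Finsupp.sum_fintype _ _ (by simp)]
    simpa using (hp s hs).1
  simpa [Nat.cast_smul_eq_nsmul] using h.sum_weight_X_mul_pderiv

theorem sum_X_mul_pderiv_inr (hp : IsBihomogeneous p a b) :
    ∑ i, X (Sum.inr i) * pderiv (Sum.inr i) p = (b : ℂ) • p := by
  have h : IsWeightedHomogeneous (Sum.elim (fun _ => 0) (fun _ => 1) : ι ⊕ ι → ℕ) p b := by
    intro s hs
    rw [Finsupp.weight_apply, Finsupp.sum_fintype _ _ (by simp)]
    simpa using (hp s hs).2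
  simpa [Nat.cast_smul_eq_nsmul] using h.sum_weight_X_mul_pderiv

end IsBihomogeneous

/-! ### Multiplication operators and their adjoints -/

/-- Gaussian integration by parts in `zᵢ`; on monomials, `(a + 1)! = (a + 1) a!`. -/
theorem gaussMoment_pderiv_inl (i : ι) (p : MvPolynomial (ι ⊕ ι) ℂ) :
    gaussMoment (pderiv (Sum.inl i) p) = gaussMoment (X (Sum.inr i) * p) := by
  classical
  suffices h : ∀ s, (gaussMoment ∘ₗ (pderiv (Sum.inl i)).toLinearMap) (monomial s 1) =
      (gaussMoment ∘ₗ LinearMap.mulLeft ℂ (X (Sum.inr i))) (monomial s 1) by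
    simpa only [LinearMap.comp_apply, LinearMap.mulLeft_apply, Derivation.coeFn_coe]
      using linearMap_ext_monomial h p
  intro s
  have hX : (X (Sum.inr i) : MvPolynomial (ι ⊕ ι) ℂ) * monomial s 1 =
      monomial (s + Finsupp.single (Sum.inr i) 1) 1 := by
    rw [X, monomial_mul, add_comm]; simp
  have hD : pderiv (Sum.inl i) (monomial s (1 : ℂ)) =
      (s (Sum.inl i) : ℂ) • monomial (s - Finsupp.single (Sum.inl i) 1) 1 := by
    rw [pderiv_monomial, smul_monomial]; simp
  simp only [LinearMap.comp_apply, LinearMap.mulLeft_apply, Derivation.coeFn_coe, hX, hD,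
    map_smul, gaussMoment_monomial]
  rw [← mul_prod_erase univ _ (mem_univ i), ← mul_prod_erase univ _ (mem_univ i), smul_eq_mul,
    ← mul_assoc]
  congr 1
  · rcases h : s (Sum.inl i) with _ | k
    · simp [h]
    · simp [h, Nat.factorial_succ]
  · refine prod_congr rfl fun j hj => ?_
    have : i ≠ j := (ne_of_mem_erase hj).symm
    simp [this]

/-- Gaussian integration by parts in `z̄ᵢ`. -/
theorem gaussMoment_pderiv_inr (i : ι) (p : MvPolynomial (ι ⊕ ι) ℂ) :
    gaussMoment (pderiv (Sum.inr i) p) = gaussMoment (X (Sum.inl i) * p) := by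
  classical
  suffices h : ∀ s, (gaussMoment ∘ₗ (pderiv (Sum.inr i)).toLinearMap) (monomial s 1) =
      (gaussMoment ∘ₗ LinearMap.mulLeft ℂ (X (Sum.inl i))) (monomial s 1) by
    simpa only [LinearMap.comp_apply, LinearMap.mulLeft_apply, Derivation.coeFn_coe]
      using linearMap_ext_monomial h p
  intro s
  have hX : (X (Sum.inl i) : MvPolynomial (ι ⊕ ι) ℂ) * monomial s 1 =
      monomial (s + Finsupp.single (Sum.inl i) 1) 1 := by
    rw [X, monomial_mul, add_comm]; simp
  have hD : pderiv (Sum.inr i) (monomial s (1 : ℂ)) =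
      (s (Sum.inr i) : ℂ) • monomial (s - Finsupp.single (Sum.inr i) 1) 1 := by
    rw [pderiv_monomial, smul_monomial]; simp
  simp only [LinearMap.comp_apply, LinearMap.mulLeft_apply, Derivation.coeFn_coe, hX, hD,
    map_smul, gaussMoment_monomial]
  rw [← mul_prod_erase univ _ (mem_univ i), ← mul_prod_erase univ _ (mem_univ i), smul_eq_mul,
    ← mul_assoc]
  congr 1
  · rcases h : s (Sum.inr i) with _ | k
    · simp [h]
    · by_cases h' : s (Sum.inl i) = k
      · simp [h', Nat.factorial_succ, h]
      · simp [h', h]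
  · refine prod_congr rfl fun j hj => ?_
    have : i ≠ j := (ne_of_mem_erase hj).symm
    simp [this]

/-- In the twisted Fischer pairing, multiplication by a variable is adjoint to differentiation in the
conjugate variable. -/
theorem fischer_X_mul (G : MvPolynomial (ι ⊕ ι) ℂ) (x : ι ⊕ ι) (p : MvPolynomial (ι ⊕ ι) ℂ) :
    fischer G (X x * p) = fischer (pderiv x.swap G) p := by
  classical
  suffices h : ∀ s, (fischer G ∘ₗ LinearMap.mulLeft ℂ (X x)) (monomial s 1) =
      fischer (pderiv x.swap G) (monomial s 1) by
    simpa only [LinearMap.comp_apply, LinearMap.mulLeft_apply] using linearMap_ext_monomial h p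
  intro s
  have hX : (X x : MvPolynomial (ι ⊕ ι) ℂ) * monomial s 1 =
      monomial (s + Finsupp.single x 1) 1 := by
    rw [X, monomial_mul, add_comm]; simp
  have hs : s.mapDomain Sum.swap x.swap = s x :=
    Finsupp.mapDomain_apply Sum.swap_leftInverse.injective s x
  simp only [LinearMap.comp_apply, LinearMap.mulLeft_apply, hX, fischer_monomial, coeff_pderiv,
    Finsupp.mapDomain_add, Finsupp.mapDomain_single, hs]
  rw [← mul_assoc, mul_right_comm]
  congr 1
  rw [← mul_prod_erase univ _ (mem_univ x), ← mul_prod_erase univ _ (mem_univ x), mul_right_comm]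
  congr 1
  · simp [Nat.factorial_succ]; ring
  · refine prod_congr rfl fun y hy => ?_
    have : x ≠ y := (ne_of_mem_erase hy).symm
    simp [this]

theorem fischer_sum {κ : Type*} (S : Finset κ) (G : κ → MvPolynomial (ι ⊕ ι) ℂ)
    (p : MvPolynomial (ι ⊕ ι) ℂ) : fischer (∑ k ∈ S, G k) p = ∑ k ∈ S, fischer (G k) p := by
  have h := linearMap_ext_monomial (f := fischer (∑ k ∈ S, G k)) (g := ∑ k ∈ S, fischer (G k))
    (fun s => by simp [fischer_monomial, coeff_sum, mul_sum]) p
  simpa using h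

theorem fischer_normSqPoly_mul (G p : MvPolynomial (ι ⊕ ι) ℂ) :
    fischer G (normSqPoly ι * p) = fischer (mixedLaplacian G) p := by
  rw [mixedLaplacian_apply, fischer_sum, normSqPoly, sum_mul, map_sum]
  refine sum_congr rfl fun i _ => ?_
  rw [mul_assoc, fischer_X_mul, fischer_X_mul]
  simp [pderiv_comm]

/-- Integration by parts turns `Δ` into the Euler operator `∑ zᵢ ∂/∂zᵢ`. -/
theorem gaussMoment_mixedLaplacian {p : MvPolynomial (ι ⊕ ι) ℂ} {a b : ℕ}
    (hp : IsBihomogeneous p a b) : gaussMoment (mixedLaplacian p) = a * gaussMoment p := by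
  rw [mixedLaplacian_apply, map_sum]
  simp only [gaussMoment_pderiv_inr]
  rw [← map_sum, hp.sum_X_mul_pderiv_inl, map_smul, smul_eq_mul]

/-- Multiplying by `‖z‖²` rescales Gaussian moments of bihomogeneous polynomials. This is what lets
terms of different degrees be compared on one sphere. -/
theorem gaussMoment_normSqPoly_mul {p : MvPolynomial (ι ⊕ ι) ℂ} {a b : ℕ}
    (hp : IsBihomogeneous p a b) :
    gaussMoment (normSqPoly ι * p) = ((Fintype.card ι + b : ℕ) : ℂ) * gaussMoment p := by
  have h : ∀ i : ι, gaussMoment (X (Sum.inl i) * X (Sum.inr i) * p) =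
      gaussMoment p + gaussMoment (X (Sum.inr i) * pderiv (Sum.inr i) p) := by
    intro i
    rw [mul_assoc, ← gaussMoment_pderiv_inr, pderiv_mul, pderiv_X_self, one_mul, map_add]
  have h2 : ∑ i : ι, gaussMoment (X (Sum.inr i) * pderiv (Sum.inr i) p) = b * gaussMoment p := by
    rw [← map_sum, hp.sum_X_mul_pderiv_inr, map_smul, smul_eq_mul]
  rw [normSqPoly, sum_mul, map_sum, sum_congr rfl fun i _ => h i, sum_add_distrib, h2]
  simp; ring

theorem gaussMoment_normSqPoly_pow_mul {p : MvPolynomial (ι ⊕ ι) ℂ} {a b : ℕ}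
    (hp : IsBihomogeneous p a b) (j : ℕ) :
    gaussMoment (normSqPoly ι ^ j * p) =
      ((Fintype.card ι + b).ascFactorial j : ℂ) * gaussMoment p := by
  induction j with
  | zero => simp
  | succ j ih =>
    rw [pow_succ', mul_assoc,
      gaussMoment_normSqPoly_mul ((IsBihomogeneous.normSqPoly_pow j).mul hp), ih,
      Nat.ascFactorial_succ]
    push_cast; ring

/-- Pairing with `‖z‖^{2N}` is `N!` times the Gaussian moment: both sides are compared through `Δ`,
the adjoint of multiplication by `‖z‖²`. -/
theorem fischer_normSqPoly_pow {G : MvPolynomial (ι ⊕ ι) ℂ} {N : ℕ}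
    (hG : IsBihomogeneous G N N) :
    fischer G (normSqPoly ι ^ N) = N ! * gaussMoment G := by
  induction N generalizing G with
  | zero =>
    obtain ⟨c, rfl⟩ : ∃ c, G = monomial 0 c := by
      refine ⟨coeff 0 G, ?_⟩
      classical
      ext s
      rw [coeff_monomial]
      split_ifs with h
      · rw [h]
      · by_contra h'
        have := hG s h'
        simp at this
        apply h
        ext (i | i) <;> simp [this]
    have h1 : gaussMoment (monomial (0 : ι ⊕ ι →₀ ℕ) c) = c := by
      rw [show monomial (0 : ι ⊕ ι →₀ ℕ) c = c • monomial 0 1 by rw [smul_monomial]; simp, map_smul,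
        gaussMoment_monomial]
      simp
    rw [pow_zero, h1, ← C_1, C_apply, fischer_monomial]
    simp
  | succ N ih =>
    rw [pow_succ', fischer_normSqPoly_mul, ih hG.mixedLaplacian, gaussMoment_mixedLaplacian hG,
      Nat.factorial_succ]
    push_cast; ring

/-! ### Passing from the Fischer pairing to Gaussian moments -/

theorem pderiv_mixedLaplacian_pow (x : ι ⊕ ι) (j : ℕ) (p : MvPolynomial (ι ⊕ ι) ℂ) :
    pderiv x ((mixedLaplacian ^ j) p) = (mixedLaplacian ^ j) (pderiv x p) := by
  induction j with
  | zero => simp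
  | succ j ih =>
    simp only [pow_succ', Module.End.mul_apply, mixedLaplacian_apply, map_sum, ← ih]
    refine sum_congr rfl fun i _ => ?_
    rw [pderiv_comm x, pderiv_comm x]

theorem mixedLaplacian_X_mul (x : ι ⊕ ι) (p : MvPolynomial (ι ⊕ ι) ℂ) :
    mixedLaplacian (X x * p) = X x * mixedLaplacian p + pderiv x.swap p := by
  classical
  have hl : ∀ i k : ι, (pderiv (Sum.inl i)) (X (Sum.inl k) : MvPolynomial (ι ⊕ ι) ℂ) =
      if k = i then 1 else 0 := by
    intro i k; rw [pderiv_X, Pi.single_apply]; simp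
  have hr : ∀ i k : ι, (pderiv (Sum.inr i)) (X (Sum.inr k) : MvPolynomial (ι ⊕ ι) ℂ) =
      if k = i then 1 else 0 := by
    intro i k; rw [pderiv_X, Pi.single_apply]; simp
  have hlr : ∀ i k : ι, (pderiv (Sum.inl i)) (X (Sum.inr k) : MvPolynomial (ι ⊕ ι) ℂ) = 0 := by
    intro i k; exact pderiv_X_of_ne (by simp)
  have hrl : ∀ i k : ι, (pderiv (Sum.inr i)) (X (Sum.inl k) : MvPolynomial (ι ⊕ ι) ℂ) = 0 := by
    intro i k; exact pderiv_X_of_ne (by simp)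
  rcases x with k | k
  · simp only [mixedLaplacian_apply, pderiv_mul, hl, hrl, map_add, zero_mul, zero_add, mul_sum]
    rw [sum_congr rfl (g := fun i => (if k = i then pderiv (Sum.inr k) p else 0) +
      X (Sum.inl k) * pderiv (Sum.inr i) (pderiv (Sum.inl i) p))]
    · rw [sum_add_distrib]; simp [add_comm]
    · intro i _; split_ifs with h <;> simp [h]
  · simp only [mixedLaplacian_apply, pderiv_mul, hr, hlr, zero_mul, zero_add, mul_sum]
    rw [sum_add_distrib]
    simp [add_comm]

theorem mixedLaplacian_pow_X_mul (x : ι ⊕ ι) (j : ℕ) (p : MvPolynomial (ι ⊕ ι) ℂ) :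
    (mixedLaplacian ^ (j + 1)) (X x * p) = X x * (mixedLaplacian ^ (j + 1)) p +
      ((j + 1 : ℕ) : ℂ) • pderiv x.swap ((mixedLaplacian ^ j) p) := by
  induction j with
  | zero => simp [mixedLaplacian_X_mul]
  | succ j ih =>
    rw [pow_succ' mixedLaplacian (j + 1), Module.End.mul_apply, ih, map_add,
      mixedLaplacian_X_mul, map_smul, Module.End.mul_apply, add_assoc]
    congr 1
    have : mixedLaplacian (pderiv x.swap ((mixedLaplacian ^ j) p)) =
        pderiv x.swap ((mixedLaplacian ^ (j + 1)) p) := by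
      have h := pderiv_mixedLaplacian_pow x.swap 1 ((mixedLaplacian ^ j) p)
      simp only [pow_one] at h
      rw [← h, pow_succ', Module.End.mul_apply]
    rw [this]
    push_cast
    module

theorem heat_apply (M : ℕ) (p : MvPolynomial (ι ⊕ ι) ℂ) :
    heat M p = ∑ j ∈ range M, ((-1 : ℂ) ^ j / (j ! : ℂ)) • (mixedLaplacian ^ j) p := by
  simp [heat]

/-- The commutator `[Δ, zᵢ] = ∂/∂z̄ᵢ` exponentiated: `e^{-Δ} zᵢ = (zᵢ - ∂/∂z̄ᵢ) e^{-Δ}`. The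
truncation drops by one in the second term. -/
theorem heat_X_mul (x : ι ⊕ ι) (M : ℕ) (p : MvPolynomial (ι ⊕ ι) ℂ) :
    heat (M + 1) (X x * p) = X x * heat (M + 1) p - pderiv x.swap (heat M p) := by
  simp only [heat_apply, sum_range_succ' _ M, mixedLaplacian_pow_X_mul, mul_add, mul_sum, map_sum,
    smul_add, sum_add_distrib]
  have h : ∀ j ∈ range M, ((-1 : ℂ) ^ (j + 1) / ((j + 1)! : ℂ)) • ((j + 1 : ℕ) : ℂ) •
      pderiv x.swap ((mixedLaplacian ^ j) p) =
      - pderiv x.swap (((-1 : ℂ) ^ j / (j ! : ℂ)) • (mixedLaplacian ^ j) p) := by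
    intro j _
    rw [Derivation.map_smul, smul_smul, ← neg_smul]
    congr 1
    have : (j ! : ℂ) ≠ 0 := by exact_mod_cast j.factorial_ne_zero
    rw [Nat.factorial_succ]
    push_cast
    have h2 : (j + 1 : ℂ) ≠ 0 := by exact_mod_cast j.succ_ne_zero
    field_simp
    ring
  rw [sum_congr rfl h, sum_neg_distrib]
  simp
  ring

/-- Gaussian integration by parts, for both kinds of variables at once. -/
theorem gaussMoment_swap (x : ι ⊕ ι) (p : MvPolynomial (ι ⊕ ι) ℂ) :
    gaussMoment (pderiv x.swap p) = gaussMoment (X x * p) := by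
  rcases x with i | i
  · exact gaussMoment_pderiv_inr i p
  · exact gaussMoment_pderiv_inl i p

/-- The case of monomials of `fischer_normSqPoly_pow_mul`, by induction on the degree: removing one
variable differentiates `G` on the left, and on the right is integration by parts combined with
`heat_X_mul`. -/
theorem fischer_normSqPoly_pow_mul_monomial (d : ℕ) (s : ι ⊕ ι →₀ ℕ) (hs : s.degree = d)
    (N M : ℕ) (hM : d < M) (G : MvPolynomial (ι ⊕ ι) ℂ)
    (hG : IsBihomogeneous G (∑ i, s (Sum.inr i) + N) (∑ i, s (Sum.inl i) + N)) :
    fischer G (normSqPoly ι ^ N * monomial s 1) =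
      N ! * gaussMoment (heat M (monomial s 1) * G) := by
  classical
  induction d generalizing s G M with
  | zero =>
    obtain rfl : s = 0 := by simpa [Finsupp.degree_eq_zero_iff] using hs
    obtain ⟨M, rfl⟩ : ∃ k, M = k + 1 := ⟨M - 1, by omega⟩
    have h1 : heat (M + 1) (monomial (0 : ι ⊕ ι →₀ ℕ) (1 : ℂ)) = 1 := by
      rw [heat_apply, sum_eq_single 0]
      · simp
      · intro j _ hj
        rw [(IsBihomogeneous.monomial (0 : ι ⊕ ι →₀ ℕ) (1 : ℂ)).mixedLaplacian_pow_eq_zero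
          (by simp; omega), smul_zero]
      · simp
    rw [h1, one_mul, ← C_apply, C_1, mul_one, fischer_normSqPoly_pow (by simpa using hG)]
  | succ d ih =>
    obtain ⟨x, hx⟩ : ∃ x, s x ≠ 0 := by
      by_contra! h
      have : s = 0 := Finsupp.ext h
      simp [this] at hs
    obtain ⟨t, rfl⟩ : ∃ t, s = Finsupp.single x 1 + t :=
      ⟨s - Finsupp.single x 1, (add_tsub_cancel_of_le (by
        rw [Finsupp.single_le_iff]; exact Nat.one_le_iff_ne_zero.2 hx)).symm⟩
    obtain ⟨M, rfl⟩ : ∃ k, M = k + 1 := ⟨M - 1, by omega⟩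
    have hX : monomial (Finsupp.single x 1 + t) (1 : ℂ) = X x * monomial t 1 := by
      rw [X, monomial_mul]; simp
    have ht : t.degree = d := by
      rw [map_add, Finsupp.degree_single] at hs; omega
    have hG' : IsBihomogeneous (pderiv x.swap G) (∑ i, t (Sum.inr i) + N)
        (∑ i, t (Sum.inl i) + N) := by
      rcases x with i | i
      · rw [Sum.swap_inl]
        have h := hG.pderiv_inr i
        simp [sum_add_distrib, Finsupp.single_apply] at h
        convert h using 1
        omega
      · rw [Sum.swap_inr]
        have h := hG.pderiv_inl i
        simp [sum_add_distrib, Finsupp.single_apply] at h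
        convert h using 1
        omega
    have hle : ∑ i, t (Sum.inl i) < M := by
      have : t.degree = ∑ i, t (Sum.inl i) + ∑ i, t (Sum.inr i) := by
        rw [Finsupp.degree_eq_sum, Fintype.sum_sum_type]
      omega
    -- The extra term of the longer truncation vanishes because `M` exceeds the degree of `t`.
    have hheat : heat (M + 1) (monomial t (1 : ℂ)) = heat M (monomial t 1) := by
      rw [heat_apply, sum_range_succ, ← heat_apply,
        (IsBihomogeneous.monomial t (1 : ℂ)).mixedLaplacian_pow_eq_zero hle, smul_zero, add_zero]
    rw [hX, mul_left_comm, fischer_X_mul, ih t ht M (by omega) _ hG', heat_X_mul, hheat, sub_mul,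
      map_sub, mul_assoc, ← gaussMoment_swap, pderiv_mul, map_add]
    ring

/-- The Fischer pairing with `‖z‖^{2N} f` is a Gaussian integral of `G` against the symbol `e^{-Δ} f`.
In the language of quantization, the normally ordered operator of `f` is rewritten in antinormal
order. -/
theorem fischer_normSqPoly_pow_mul {f G : MvPolynomial (ι ⊕ ι) ℂ} {a b N M : ℕ}
    (hf : IsBihomogeneous f a b) (hM : a + b < M) (hG : IsBihomogeneous G (b + N) (a + N)) :
    fischer G (normSqPoly ι ^ N * f) = N ! * gaussMoment (heat M f * G) := by
  have key : ∀ s ∈ f.support, fischer G (normSqPoly ι ^ N * monomial s (coeff s f)) =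
      N ! * gaussMoment (heat M (monomial s (coeff s f)) * G) := by
    intro s hs
    obtain ⟨ha, hb⟩ := hf s (mem_support_iff.1 hs)
    have h := fischer_normSqPoly_pow_mul_monomial s.degree s rfl N M
      (by rw [Finsupp.degree_eq_sum, Fintype.sum_sum_type]; omega) G (by rwa [ha, hb])
    rw [show monomial s (coeff s f) = coeff s f • monomial s 1 by simp [smul_monomial],
      mul_smul_comm, map_smul, map_smul, smul_mul_assoc, map_smul, h]
    simp only [smul_eq_mul]; ring
  conv_lhs => rw [f.as_sum]
  conv_rhs => rw [f.as_sum]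
  rw [mul_sum, map_sum, map_sum, sum_mul, map_sum, mul_sum]
  exact sum_congr rfl key

/-! ### Gaussian integrals on `ℂⁿ` -/

/-- The off-diagonal moments vanish by rotation invariance. -/
theorem integral_pow_mul_conj_pow_of_ne {a b : ℕ} (hab : a ≠ b) :
    ∫ z : ℂ, z ^ a * conj z ^ b * (Real.exp (-‖z‖ ^ 2) : ℂ) = 0 := by
  have hab' : (a : ℂ) - b ≠ 0 := sub_ne_zero.2 (by exact_mod_cast hab)
  -- The rotation by `π / (a - b)` multiplies the integrand by `-1`.
  set u : Circle := Circle.exp (Real.pi / ((a : ℝ) - b)) with hu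
  have hrot : (u : ℂ) ^ a * conj (u : ℂ) ^ b = -1 := by
    rw [hu, Circle.coe_exp, ← Complex.exp_conj, ← Complex.exp_nat_mul, ← Complex.exp_nat_mul,
      ← Complex.exp_add, ← Complex.exp_pi_mul_I]
    congr 1
    simp
    field_simp
    ring
  have h := (rotation u).measurePreserving.integral_comp
    (rotation u).toHomeomorph.measurableEmbedding
    (fun z : ℂ => z ^ a * conj z ^ b * (Real.exp (-‖z‖ ^ 2) : ℂ))
  have h2 : ∀ z : ℂ, (rotation u z) ^ a * conj (rotation u z) ^ b *
      (Real.exp (-‖rotation u z‖ ^ 2) : ℂ) =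
      (-1) * (z ^ a * conj z ^ b * (Real.exp (-‖z‖ ^ 2) : ℂ)) := by
    intro z
    rw [LinearIsometryEquiv.norm_map, rotation_apply, map_mul, mul_pow, mul_pow, ← hrot]
    ring
  simp only [h2] at h
  rw [integral_const_mul] at h
  linear_combination (-1 / 2 : ℂ) * h

theorem integral_norm_pow_mul_exp (a : ℕ) :
    ∫ z : ℂ, ‖z‖ ^ a * Real.exp (-‖z‖ ^ 2) = Real.pi * Real.Gamma ((a + 2) / 2) := by
  have h := Complex.integral_rpow_mul_exp_neg_rpow (p := 2) (q := a) (by norm_num)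
    (by have : (0 : ℝ) ≤ a := a.cast_nonneg
        linarith)
  simp only [Real.rpow_natCast, Real.rpow_two] at h
  rw [h, mul_div_cancel_left₀ _ (two_ne_zero' ℝ)]

theorem integrable_pow_mul_conj_pow (a b : ℕ) :
    Integrable fun z : ℂ => z ^ a * conj z ^ b * (Real.exp (-‖z‖ ^ 2) : ℂ) := by
  have h : Integrable fun z : ℂ => ‖z‖ ^ (a + b) * Real.exp (-‖z‖ ^ 2) := by
    -- The Bochner integral of a non-integrable function is `0`, whereas this one is positive.
    apply Integrable.of_integral_ne_zero
    rw [integral_norm_pow_mul_exp]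
    exact (mul_pos Real.pi_pos (Real.Gamma_pos_of_pos (by positivity))).ne'
  refine h.mono' (by fun_prop) (Filter.Eventually.of_forall fun z => le_of_eq ?_)
  rw [norm_mul, norm_mul, norm_pow, norm_pow, RCLike.norm_conj, pow_add, Complex.norm_real,
    Real.norm_of_nonneg (Real.exp_nonneg _)]

theorem integral_pow_mul_conj_pow (a b : ℕ) :
    ∫ z : ℂ, z ^ a * conj z ^ b * (Real.exp (-‖z‖ ^ 2) : ℂ) =
      Real.pi * if a = b then (a ! : ℂ) else 0 := by
  split_ifs with h
  · subst h
    have h1 : ∀ z : ℂ, z ^ a * conj z ^ a * (Real.exp (-‖z‖ ^ 2) : ℂ) =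
        ((‖z‖ ^ (2 * a) * Real.exp (-‖z‖ ^ 2) : ℝ) : ℂ) := by
      intro z
      rw [← mul_pow, Complex.mul_conj', pow_mul]
      push_cast; rfl
    simp only [h1]
    rw [integral_complex_ofReal, integral_norm_pow_mul_exp]
    have : ((2 * a : ℕ) + 2 : ℝ) / 2 = a + 1 := by push_cast; ring
    rw [this, Real.Gamma_nat_eq_factorial]
    push_cast; rfl
  · rw [integral_pow_mul_conj_pow_of_ne h, mul_zero]

/-- Evaluation on the diagonal: `X (inl i) ↦ zᵢ` and `X (inr i) ↦ z̄ᵢ`. -/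
noncomputable def diagEval (z : ι → ℂ) : MvPolynomial (ι ⊕ ι) ℂ →+* ℂ :=
  eval (Sum.elim z fun i => conj (z i))

theorem diagEval_monomial (z : ι → ℂ) (s : ι ⊕ ι →₀ ℕ) (c : ℂ) :
    diagEval z (monomial s c) =
      c * ∏ i, z i ^ s (Sum.inl i) * conj (z i) ^ s (Sum.inr i) := by
  rw [diagEval, eval_monomial, Finsupp.prod_fintype _ _ (by simp), Fintype.prod_sum_type,
    prod_mul_distrib]
  simp

/-- The unnormalized Gaussian density `e^{-‖z‖²}` on `ℂⁿ`, as a product over the coordinates. -/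
noncomputable def gaussWeight (z : ι → ℂ) : ℝ := ∏ i, Real.exp (-‖z i‖ ^ 2)

theorem diagEval_monomial_mul_gaussWeight (z : ι → ℂ) (s : ι ⊕ ι →₀ ℕ) :
    diagEval z (monomial s 1) * (gaussWeight z : ℂ) =
      ∏ i, z i ^ s (Sum.inl i) * conj (z i) ^ s (Sum.inr i) * (Real.exp (-‖z i‖ ^ 2) : ℂ) := by
  rw [diagEval_monomial, one_mul, gaussWeight, prod_mul_distrib (f := fun i => _ * _)]
  push_cast; rfl

theorem integrable_diagEval_monomial (s : ι ⊕ ι →₀ ℕ) :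
    Integrable fun z : ι → ℂ => diagEval z (monomial s 1) * (gaussWeight z : ℂ) := by
  simp only [diagEval_monomial_mul_gaussWeight]
  exact Integrable.fintype_prod (f := fun i (w : ℂ) =>
    w ^ s (Sum.inl i) * conj w ^ s (Sum.inr i) * (Real.exp (-‖w‖ ^ 2) : ℂ))
    fun i => integrable_pow_mul_conj_pow _ _

theorem integral_diagEval_monomial (s : ι ⊕ ι →₀ ℕ) :
    ∫ z : ι → ℂ, diagEval z (monomial s 1) * (gaussWeight z : ℂ) =
      (Real.pi : ℂ) ^ Fintype.card ι * gaussMoment (monomial s 1) := by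
  simp only [diagEval_monomial_mul_gaussWeight]
  rw [integral_fintype_prod_volume_eq_prod (f := fun i (w : ℂ) =>
    w ^ s (Sum.inl i) * conj w ^ s (Sum.inr i) * (Real.exp (-‖w‖ ^ 2) : ℂ)), gaussMoment_monomial]
  simp only [integral_pow_mul_conj_pow]
  rw [prod_mul_distrib, prod_const, card_univ]

theorem diagEval_mul_gaussWeight_eq_sum (p : MvPolynomial (ι ⊕ ι) ℂ) (z : ι → ℂ) :
    diagEval z p * (gaussWeight z : ℂ) =
      ∑ s ∈ p.support, coeff s p * (diagEval z (monomial s 1) * (gaussWeight z : ℂ)) := by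
  conv_lhs => rw [p.as_sum]
  rw [map_sum, sum_mul]
  refine sum_congr rfl fun s _ => ?_
  rw [diagEval_monomial, diagEval_monomial]
  ring

theorem integrable_diagEval (p : MvPolynomial (ι ⊕ ι) ℂ) :
    Integrable fun z : ι → ℂ => diagEval z p * (gaussWeight z : ℂ) := by
  exact (integrable_finsetSum _ fun s _ => (integrable_diagEval_monomial s).const_mul _).congr
    (Filter.Eventually.of_forall fun z => (diagEval_mul_gaussWeight_eq_sum p z).symm)

theorem integral_diagEval (p : MvPolynomial (ι ⊕ ι) ℂ) :
    ∫ z : ι → ℂ, diagEval z p * (gaussWeight z : ℂ) =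
      (Real.pi : ℂ) ^ Fintype.card ι * gaussMoment p := by
  rw [integral_congr_ae (Filter.Eventually.of_forall (diagEval_mul_gaussWeight_eq_sum p)),
    integral_finsetSum _ fun s _ => (integrable_diagEval_monomial s).const_mul _]
  simp only [integral_const_mul, integral_diagEval_monomial]
  conv_rhs => rw [p.as_sum]
  rw [map_sum, mul_sum]
  refine sum_congr rfl fun s _ => ?_
  rw [show monomial s (coeff s p) = coeff s p • monomial s 1 by rw [smul_monomial]; simp, map_smul,
    smul_eq_mul]
  ring

theorem gaussMoment_re_nonneg {p : MvPolynomial (ι ⊕ ι) ℂ}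
    (hp : ∀ z : ι → ℂ, 0 ≤ (diagEval z p).re) : 0 ≤ (gaussMoment p).re := by
  have h : 0 ≤ (∫ z : ι → ℂ, diagEval z p * (gaussWeight z : ℂ)).re := by
    rw [← RCLike.re_eq_complex_re, ← integral_re (integrable_diagEval p)]
    refine integral_nonneg fun z => ?_
    simp only [RCLike.re_eq_complex_re, Complex.re_mul_ofReal, Pi.zero_apply]
    exact mul_nonneg (hp z) (prod_nonneg fun i _ => (Real.exp_pos _).le)
  rw [integral_diagEval, ← Complex.ofReal_pow, Complex.re_ofReal_mul] at h
  exact nonneg_of_mul_nonneg_right h (by positivity)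

/-! ### The Fischer norm and its estimates -/

section fischerNorm
variable {σ : Type*} [Fintype σ]

/-- The squared Fischer norm `∑ₛ s! |pₛ|²`. For a form of bidegree `(m, m)` it is `m!²` times the
square of `coeffNorm`; see `fischerNormSq_bihomForm_le`. -/
noncomputable def fischerNormSq (p : MvPolynomial σ ℂ) : ℝ :=
  ∑ s ∈ p.support, (∏ x, ((s x)! : ℝ)) * ‖coeff s p‖ ^ 2

theorem fischerNormSq_nonneg (p : MvPolynomial σ ℂ) : 0 ≤ fischerNormSq p :=
  sum_nonneg fun _ _ => by positivity

theorem sum_le_fischerNormSq (p : MvPolynomial σ ℂ) (S : Finset (σ →₀ ℕ)) :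
    ∑ s ∈ S, (∏ x, ((s x)! : ℝ)) * ‖coeff s p‖ ^ 2 ≤ fischerNormSq p := by
  classical
  rw [← sum_filter_of_ne (p := fun s => s ∈ p.support)]
  · refine sum_le_sum_of_subset_of_nonneg (fun s hs => (mem_filter.1 hs).2) fun s _ _ => ?_
    positivity
  · intro s _ h
    rw [mem_support_iff]
    rintro h'
    simp [h'] at h

/-- Weighted form of the identity `s! |(∂ₓp)ₛ|² = t! tₓ |pₜ|²`, `t = s + eₓ`, summed over `s`. The
weight `w` allows it to be iterated. -/
theorem sum_pderiv_le (x : σ) (p : MvPolynomial σ ℂ) (w : (σ →₀ ℕ) → ℝ) (hw : ∀ s, 0 ≤ w s) :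
    ∑ s ∈ (pderiv x p).support, w s * ((∏ y, ((s y)! : ℝ)) * ‖coeff s (pderiv x p)‖ ^ 2) ≤
      ∑ t ∈ p.support, w (t - Finsupp.single x 1) *
        ((t x : ℝ) * ((∏ y, ((t y)! : ℝ)) * ‖coeff t p‖ ^ 2)) := by
  classical
  set h : (σ →₀ ℕ) → ℝ := fun t => w (t - Finsupp.single x 1) *
        ((t x : ℝ) * ((∏ y, ((t y)! : ℝ)) * ‖coeff t p‖ ^ 2)) with hh
  have h0 : ∀ t, 0 ≤ h t := fun t => mul_nonneg (hw _) (by positivity)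
  have h1 : ∀ s, w s * ((∏ y, ((s y)! : ℝ)) * ‖coeff s (pderiv x p)‖ ^ 2) =
      h (addRightEmbedding (Finsupp.single x 1) s) := by
    intro s
    simp only [hh, addRightEmbedding_apply, add_tsub_cancel_right, coeff_pderiv, norm_mul]
    have h2 : ∏ y, (((s + Finsupp.single x 1 : σ →₀ ℕ) y)! : ℝ) =
        (s x + 1) * ∏ y, ((s y)! : ℝ) := by
      rw [← mul_prod_erase univ _ (mem_univ x), ← mul_prod_erase univ _ (mem_univ x), ← mul_assoc]
      congr 1
      · simp [Nat.factorial_succ]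
      · refine prod_congr rfl fun y hy => ?_
        have : x ≠ y := (ne_of_mem_erase hy).symm
        simp [this]
    have h3 : ‖(s x : ℂ) + 1‖ = s x + 1 := by
      rw [← Nat.cast_succ, Complex.norm_natCast]; push_cast; rfl
    rw [h2, h3]
    simp only [Finsupp.coe_add, Pi.add_apply, Finsupp.single_eq_same]
    push_cast
    ring
  rw [sum_congr rfl fun s _ => h1 s, ← sum_map _ _ h]
  refine sum_le_sum_of_subset_of_nonneg (fun t ht => ?_) fun t _ _ => h0 t
  obtain ⟨s, hs, rfl⟩ := mem_map.1 ht
  rw [mem_support_iff, coeff_pderiv] at hs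
  exact mem_support_iff.2 (left_ne_zero_of_mul hs)

theorem fischerNormSq_pderiv_le (x : σ) (p : MvPolynomial σ ℂ) :
    fischerNormSq (pderiv x p) ≤
      ∑ t ∈ p.support, (t x : ℝ) * ((∏ y, ((t y)! : ℝ)) * ‖coeff t p‖ ^ 2) := by
  simpa [fischerNormSq] using sum_pderiv_le x p (fun _ => 1) (fun _ => zero_le_one)

theorem fischerNormSq_pderiv_pderiv_le {x y : σ} (hxy : x ≠ y) (p : MvPolynomial σ ℂ) :
    fischerNormSq (pderiv y (pderiv x p)) ≤
      ∑ t ∈ p.support, ((t x : ℝ) * t y) * ((∏ y, ((t y)! : ℝ)) * ‖coeff t p‖ ^ 2) := by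
  refine (fischerNormSq_pderiv_le y (pderiv x p)).trans ?_
  refine (sum_pderiv_le x p (fun s => (s y : ℝ)) (fun s => Nat.cast_nonneg _)).trans (le_of_eq ?_)
  refine sum_congr rfl fun t _ => ?_
  simp [hxy]
  ring

end fischerNorm

theorem fischerNormSq_mixedLaplacian_le {p : MvPolynomial (ι ⊕ ι) ℂ} {a b : ℕ}
    (hp : IsBihomogeneous p a b) :
    fischerNormSq (mixedLaplacian p) ≤ Fintype.card ι * (a * b) * fischerNormSq p := by
  set q : ι → MvPolynomial (ι ⊕ ι) ℂ := fun i => pderiv (Sum.inr i) (pderiv (Sum.inl i) p) with hq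
  have h1 : ∀ s, ‖coeff s (mixedLaplacian p)‖ ^ 2 ≤
      Fintype.card ι * ∑ i, ‖coeff s (q i)‖ ^ 2 := by
    intro s
    rw [mixedLaplacian_apply, coeff_sum]
    calc ‖∑ i, coeff s (q i)‖ ^ 2 ≤ (∑ i, ‖coeff s (q i)‖) ^ 2 := by
          gcongr; exact norm_sum_le _ _
      _ ≤ _ := by simpa using sq_sum_le_card_mul_sum_sq (s := univ) (f := fun i => ‖coeff s (q i)‖)
  calc fischerNormSq (mixedLaplacian p)
      ≤ ∑ s ∈ (mixedLaplacian p).support, (∏ x, ((s x)! : ℝ)) *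
          (Fintype.card ι * ∑ i, ‖coeff s (q i)‖ ^ 2) := by
        refine sum_le_sum fun s _ => ?_
        gcongr
        exact h1 s
    _ = Fintype.card ι * ∑ i, ∑ s ∈ (mixedLaplacian p).support,
          (∏ x, ((s x)! : ℝ)) * ‖coeff s (q i)‖ ^ 2 := by
        rw [sum_comm, mul_sum]
        refine sum_congr rfl fun s _ => ?_
        rw [← mul_sum]; ring
    _ ≤ Fintype.card ι * ∑ i, ∑ t ∈ p.support, ((t (Sum.inl i) : ℝ) * t (Sum.inr i)) *
          ((∏ y, ((t y)! : ℝ)) * ‖coeff t p‖ ^ 2) := by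
        gcongr with i
        exact (sum_le_fischerNormSq _ _).trans (fischerNormSq_pderiv_pderiv_le (by simp) p)
    _ ≤ Fintype.card ι * ∑ t ∈ p.support, ((a : ℝ) * b) *
          ((∏ y, ((t y)! : ℝ)) * ‖coeff t p‖ ^ 2) := by
        rw [sum_comm]
        gcongr with t ht
        rw [← sum_mul]
        gcongr
        obtain ⟨rfl, rfl⟩ := hp t (mem_support_iff.1 ht)
        rw [← Nat.cast_mul, sum_mul]
        push_cast
        gcongr with i
        exact_mod_cast single_le_sum (f := fun i => t (Sum.inr i)) (fun _ _ => Nat.zero_le _)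
          (mem_univ i)
    _ = _ := by rw [← mul_sum, fischerNormSq]; ring

theorem fischerNormSq_mixedLaplacian_pow_le {p : MvPolynomial (ι ⊕ ι) ℂ} {m : ℕ}
    (hp : IsBihomogeneous p m m) {j : ℕ} (hj : j ≤ m) :
    fischerNormSq ((mixedLaplacian ^ j) p) / ((m - j)! : ℝ) ^ 2 ≤
      (Fintype.card ι * (m : ℝ) ^ 4) ^ j * (fischerNormSq p / (m ! : ℝ) ^ 2) := by
  induction j with
  | zero => simp
  | succ j ih =>
    obtain ⟨k, hk⟩ : ∃ k, m - j = k + 1 := ⟨m - j - 1, by omega⟩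
    have hk' : m - (j + 1) = k := by omega
    have h := fischerNormSq_mixedLaplacian_le (hp.mixedLaplacian_pow j)
    rw [hk] at h
    have ih := ih (by omega)
    rw [hk] at ih
    rw [hk', pow_succ' mixedLaplacian, Module.End.mul_apply]
    have hkm : ((k + 1 : ℕ) : ℝ) ≤ m := by exact_mod_cast (by omega : k + 1 ≤ m)
    have hfac : (k ! : ℝ) ≠ 0 := by exact_mod_cast k.factorial_ne_zero
    calc fischerNormSq (mixedLaplacian ((mixedLaplacian ^ j) p)) / (k ! : ℝ) ^ 2
        ≤ Fintype.card ι * (((k + 1 : ℕ) : ℝ) * ((k + 1 : ℕ) : ℝ)) *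
            fischerNormSq ((mixedLaplacian ^ j) p) / (k ! : ℝ) ^ 2 := by gcongr
      _ = (Fintype.card ι * ((k + 1 : ℕ) : ℝ) ^ 4) *
            (fischerNormSq ((mixedLaplacian ^ j) p) / ((k + 1)! : ℝ) ^ 2) := by
          rw [Nat.factorial_succ]
          push_cast
          field_simp
      _ ≤ (Fintype.card ι * (m : ℝ) ^ 4) *
            ((Fintype.card ι * (m : ℝ) ^ 4) ^ j * (fischerNormSq p / (m ! : ℝ) ^ 2)) := by
          gcongr
          exact div_nonneg (fischerNormSq_nonneg _) (by positivity)
      _ = _ := by ring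

/-- One step of the induction for `norm_diagEval_sq_le`: Euler's identity and Cauchy–Schwarz transfer
a pointwise bound from the first derivatives of `p` to `p`. The map `e` selects the holomorphic or
the antiholomorphic variables. -/
theorem norm_eval_sq_le_of_euler {e : ι → ι ⊕ ι} {p : MvPolynomial (ι ⊕ ι) ℂ} {d : ℕ} {K : ℝ}
    (z : ι → ℂ) (hz : ∀ i, ‖diagEval z (X (e i))‖ = ‖z i‖)
    (hdeg : ∀ s ∈ p.support, ∑ i, s (e i) = d + 1)
    (heuler : ∑ i, X (e i) * pderiv (e i) p = ((d + 1 : ℕ) : ℂ) • p)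
    (hD : ∀ i, ‖diagEval z (pderiv (e i) p)‖ ^ 2 ≤ fischerNormSq (pderiv (e i) p) * K)
    (hK : 0 ≤ K) :
    ‖diagEval z p‖ ^ 2 ≤ fischerNormSq p * ((∑ i, ‖z i‖ ^ 2) * K / (d + 1)) := by
  have hd : (0 : ℝ) < d + 1 := by positivity
  have h1 : ((d : ℝ) + 1) * ‖diagEval z p‖ ≤ ∑ i, ‖z i‖ * ‖diagEval z (pderiv (e i) p)‖ := by
    have h := congrArg (fun q => ‖diagEval z q‖) heuler
    simp only [smul_eq_C_mul, map_mul, norm_mul, map_sum] at h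
    rw [diagEval, eval_C, Complex.norm_natCast, ← diagEval] at h
    push_cast at h
    rw [← h]
    refine (norm_sum_le _ _).trans (le_of_eq (sum_congr rfl fun i _ => ?_))
    rw [norm_mul, hz]
  have h2 : ∑ i, fischerNormSq (pderiv (e i) p) ≤ (d + 1) * fischerNormSq p := by
    calc ∑ i, fischerNormSq (pderiv (e i) p)
        ≤ ∑ i, ∑ t ∈ p.support, (t (e i) : ℝ) * ((∏ y, ((t y)! : ℝ)) * ‖coeff t p‖ ^ 2) :=
          sum_le_sum fun i _ => fischerNormSq_pderiv_le _ _
      _ = _ := by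
          rw [sum_comm, fischerNormSq, mul_sum]
          refine sum_congr rfl fun t ht => ?_
          rw [← sum_mul, ← Nat.cast_sum, hdeg t ht]
          push_cast; rfl
  have h3 : (((d : ℝ) + 1) * ‖diagEval z p‖) ^ 2 ≤
      (∑ i, ‖z i‖ ^ 2) * (((d + 1) * fischerNormSq p) * K) := by
    calc (((d : ℝ) + 1) * ‖diagEval z p‖) ^ 2
        ≤ (∑ i, ‖z i‖ * ‖diagEval z (pderiv (e i) p)‖) ^ 2 := by gcongr
      _ ≤ (∑ i, ‖z i‖ ^ 2) * ∑ i, ‖diagEval z (pderiv (e i) p)‖ ^ 2 :=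
          sum_mul_sq_le_sq_mul_sq _ _ _
      _ ≤ (∑ i, ‖z i‖ ^ 2) * ∑ i, fischerNormSq (pderiv (e i) p) * K := by
          gcongr with i; exact hD i
      _ ≤ _ := by
          rw [← sum_mul]
          gcongr
  rw [mul_pow] at h3
  rw [mul_div_assoc', le_div_iff₀ hd]
  nlinarith [h3]

/-- Bidegree version of the reproducing kernel bound of the Fischer space: the kernel restricted to
bidegree `(a, b)` has diagonal value `‖z‖^{2(a+b)} / (a! b!)`. -/
theorem norm_diagEval_sq_le {p : MvPolynomial (ι ⊕ ι) ℂ} {a b : ℕ} (hp : IsBihomogeneous p a b)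
    (z : ι → ℂ) :
    ‖diagEval z p‖ ^ 2 ≤ fischerNormSq p * ((∑ i, ‖z i‖ ^ 2) ^ (a + b) / (a ! * b !)) := by
  induction a generalizing p with
  | zero =>
    induction b generalizing p with
    | zero =>
      have hsupp : ∀ s ∈ p.support, s = 0 := by
        intro s hs
        have := hp s (mem_support_iff.1 hs)
        simp at this
        ext (i | i) <;> simp [this]
      have hp0 : p = monomial 0 (coeff 0 p) := by
        classical
        ext s
        rw [coeff_monomial]
        split_ifs with h
        · rw [h]
        · by_contra h'
          exact h (hsupp s (mem_support_iff.2 h')).symm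
      have h1 := sum_le_fischerNormSq p {0}
      rw [hp0, diagEval_monomial]
      rw [← hp0]
      simpa using h1
    | succ b ih =>
      refine (norm_eval_sq_le_of_euler (e := Sum.inr) (d := b)
        (K := (∑ i, ‖z i‖ ^ 2) ^ (0 + b) / (0 ! * b !)) z (by simp [diagEval])
        (fun s hs => (hp s (mem_support_iff.1 hs)).2) hp.sum_X_mul_pderiv_inr
        (fun i => ih (hp.pderiv_inr i)) (by positivity)).trans (le_of_eq ?_)
      have : (b ! : ℝ) ≠ 0 := by exact_mod_cast b.factorial_ne_zero
      rw [Nat.factorial_succ]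
      push_cast
      field_simp
      ring
  | succ a ih =>
    refine (norm_eval_sq_le_of_euler (e := Sum.inl) (d := a)
      (K := (∑ i, ‖z i‖ ^ 2) ^ (a + b) / (a ! * b !)) z (by simp [diagEval])
      (fun s hs => (hp s (mem_support_iff.1 hs)).1) hp.sum_X_mul_pderiv_inl
      (fun i => ih (hp.pderiv_inl i)) (by positivity)).trans (le_of_eq ?_)
    have : (a ! : ℝ) ≠ 0 := by exact_mod_cast a.factorial_ne_zero
    have : (b ! : ℝ) ≠ 0 := by exact_mod_cast b.factorial_ne_zero
    rw [Nat.factorial_succ]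
    push_cast
    field_simp
    ring

theorem norm_diagEval_mixedLaplacian_pow_le {f : MvPolynomial (ι ⊕ ι) ℂ} {m : ℕ}
    (hf : IsBihomogeneous f m m) {Λ : ℝ} (hΛ : 0 ≤ Λ)
    (hfΛ : fischerNormSq f ≤ (m ! * Λ) ^ 2) {j : ℕ} (hj : j ≤ m) (z : ι → ℂ) :
    ‖diagEval z ((mixedLaplacian ^ j) f)‖ ≤
      (√(Fintype.card ι) * m ^ 2) ^ j * Λ * (∑ i, ‖z i‖ ^ 2) ^ (m - j) := by
  refine le_of_sq_le_sq ?_ (by positivity)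
  have hfac : (m ! : ℝ) ≠ 0 := by exact_mod_cast m.factorial_ne_zero
  have hfac' : ((m - j)! : ℝ) ≠ 0 := by exact_mod_cast (m - j).factorial_ne_zero
  have h1 : fischerNormSq f / (m ! : ℝ) ^ 2 ≤ Λ ^ 2 := by
    rw [div_le_iff₀ (by positivity)]
    linarith [hfΛ, mul_pow (m ! : ℝ) Λ 2]
  calc ‖diagEval z ((mixedLaplacian ^ j) f)‖ ^ 2
      ≤ _ := norm_diagEval_sq_le (hf.mixedLaplacian_pow j) z
    _ = fischerNormSq ((mixedLaplacian ^ j) f) / ((m - j)! : ℝ) ^ 2 *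
          (∑ i, ‖z i‖ ^ 2) ^ (m - j + (m - j)) := by field_simp
    _ ≤ (Fintype.card ι * (m : ℝ) ^ 4) ^ j * Λ ^ 2 * (∑ i, ‖z i‖ ^ 2) ^ (m - j + (m - j)) := by
        gcongr
        exact (fischerNormSq_mixedLaplacian_pow_le hf hj).trans (by gcongr)
    _ = _ := by
        have h2 : Fintype.card ι * (m : ℝ) ^ 4 = (√(Fintype.card ι) * m ^ 2) ^ 2 := by
          rw [mul_pow, Real.sq_sqrt (by positivity)]; ring
        rw [h2]
        ring

/-! ### The antinormal symbol and its positivity -/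

theorem diagEval_normSqPoly (z : ι → ℂ) :
    diagEval z (normSqPoly ι) = ((∑ i, ‖z i‖ ^ 2 : ℝ) : ℂ) := by
  simp [diagEval, normSqPoly, Complex.mul_conj']

/-- The polynomial `∑ⱼ (-1)ʲ / (j! κⱼ) ‖z‖^{2j} Δʲ f` with `κⱼ = (n + 2m + N - j) ⋯ (n + 2m + N - 1)`
for `j ≤ m` (the later terms vanish for `f` of bidegree `(m, m)`). It is the symbol `e^{-Δ} f` made
bihomogeneous: by `gaussMoment_normSqPoly_pow_mul` it has the same Gaussian moments against every
`G` of bidegree `(m + N, m + N)`. -/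
noncomputable def upperSymbol (N m : ℕ) (f : MvPolynomial (ι ⊕ ι) ℂ) : MvPolynomial (ι ⊕ ι) ℂ :=
  ∑ j ∈ range (m + m + 1),
    ((-1 : ℂ) ^ j / ((j ! : ℂ) * (Fintype.card ι + (m - j + (m + N))).ascFactorial j)) •
      (normSqPoly ι ^ j * (mixedLaplacian ^ j) f)

theorem fischer_eq_gaussMoment_upperSymbol {f G : MvPolynomial (ι ⊕ ι) ℂ} {m N : ℕ} (hN : 0 < N)
    (hf : IsBihomogeneous f m m) (hG : IsBihomogeneous G (m + N) (m + N)) :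
    fischer G (normSqPoly ι ^ N * f) = N ! * gaussMoment (upperSymbol N m f * G) := by
  rw [fischer_normSqPoly_pow_mul hf (Nat.lt_succ_self _) hG, heat_apply, upperSymbol, sum_mul,
    sum_mul, map_sum, map_sum]
  congr 1
  refine sum_congr rfl fun j _ => ?_
  have h := gaussMoment_normSqPoly_pow_mul ((hf.mixedLaplacian_pow j).mul hG) j
  have h0 : (((Fintype.card ι + (m - j + (m + N))).ascFactorial j : ℕ) : ℂ) ≠ 0 := by
    rw [show Fintype.card ι + (m - j + (m + N)) =
      (Fintype.card ι + (m - j + m) + N - 1) + 1 by omega]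
    exact_mod_cast (Nat.ascFactorial_pos _ j).ne'
  have h1 : (j ! : ℂ) ≠ 0 := by exact_mod_cast j.factorial_ne_zero
  rw [smul_mul_assoc, smul_mul_assoc, map_smul, map_smul, mul_assoc, h]
  simp only [smul_eq_mul]
  field_simp

/-- The `j`-th correction is at most `Λ ‖z‖^{2m} xʲ / j!` with `x = √n m² / N`, so the corrections sum
to at most `Λ (eˣ - 1) ‖z‖^{2m}`, which the lower bound `μ ‖z‖^{2m}` of `f` absorbs. -/
theorem diagEval_upperSymbol_re_nonneg {f : MvPolynomial (ι ⊕ ι) ℂ} {m N : ℕ} (hN : 0 < N)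
    (hf : IsBihomogeneous f m m) {μ Λ : ℝ} (hΛ : 0 ≤ Λ)
    (hfΛ : fischerNormSq f ≤ (m ! * Λ) ^ 2)
    (hμ : ∀ z : ι → ℂ, μ * (∑ i, ‖z i‖ ^ 2) ^ m ≤ (diagEval z f).re)
    (hexp : Λ * (Real.exp (√(Fintype.card ι) * m ^ 2 / N) - 1) ≤ μ) (z : ι → ℂ) :
    0 ≤ (diagEval z (upperSymbol N m f)).re := by
  set R : ℝ := ∑ i, ‖z i‖ ^ 2 with hR
  have hR0 : 0 ≤ R := by positivity
  have hN' : (0 : ℝ) < N := by exact_mod_cast hN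
  set x : ℝ := √(Fintype.card ι) * m ^ 2 / N with hx
  have hx0 : 0 ≤ x := by positivity
  set t : ℕ → ℂ := fun j => ((-1 : ℂ) ^ j /
    ((j ! : ℂ) * (Fintype.card ι + (m - j + (m + N))).ascFactorial j)) *
      ((R : ℂ) ^ j * diagEval z ((mixedLaplacian ^ j) f)) with ht
  have hsum : diagEval z (upperSymbol N m f) = ∑ j ∈ range (m + m + 1), t j := by
    simp only [upperSymbol, map_sum, smul_eq_C_mul, map_mul, map_pow, diagEval_normSqPoly, ht]
    simp only [diagEval, eval_C, hR]
  have hbound : ∀ j, ‖t j‖ ≤ R ^ m * Λ * (x ^ j / j !) := by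
    intro j
    rcases le_or_gt j m with hj | hj
    · have h1 := norm_diagEval_mixedLaplacian_pow_le hf hΛ hfΛ hj z
      have h2 : (N : ℝ) ^ j ≤ ((Fintype.card ι + (m - j + (m + N))).ascFactorial j : ℕ) := by
        have h3 : (Fintype.card ι + (m - j + (m + N))) ^ j ≤
          (Fintype.card ι + (m - j + (m + N))).ascFactorial j := Nat.pow_succ_le_ascFactorial _ _
        have h4 : N ^ j ≤ (Fintype.card ι + (m - j + (m + N))) ^ j :=
          Nat.pow_le_pow_left (by omega) j
        exact_mod_cast h4.trans h3
      have hj0 : (0 : ℝ) < j ! := by exact_mod_cast j.factorial_pos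
      calc ‖t j‖ = 1 / (j ! * ((Fintype.card ι + (m - j + (m + N))).ascFactorial j : ℕ)) *
            (R ^ j * ‖diagEval z ((mixedLaplacian ^ j) f)‖) := by
            simp only [ht, norm_mul, norm_div, norm_pow, norm_neg, norm_one, one_pow,
              Complex.norm_natCast, Complex.norm_real, Real.norm_of_nonneg hR0]
        _ ≤ 1 / (j ! * (N : ℝ) ^ j) *
            (R ^ j * ((√(Fintype.card ι) * m ^ 2) ^ j * Λ * R ^ (m - j))) := by gcongr
        _ = R ^ (j + (m - j)) * Λ * (x ^ j / j !) := by
            rw [hx, div_pow]; field_simp; ring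
        _ = _ := by rw [Nat.add_sub_cancel' hj]
    · have h0 : t j = 0 := by
        simp only [ht, hf.mixedLaplacian_pow_eq_zero hj, map_zero, mul_zero]
      rw [h0, norm_zero]
      positivity
  have ht0 : t 0 = diagEval z f := by simp [ht]
  have hexp' : ∑ j ∈ range (m + m), x ^ (j + 1) / (j + 1)! ≤ Real.exp x - 1 := by
    have h := Real.sum_le_exp_of_nonneg hx0 (m + m + 1)
    rw [sum_range_succ'] at h
    simp at h
    linarith
  rw [hsum, sum_range_succ', ht0, Complex.add_re]
  have h1 : |(∑ j ∈ range (m + m), t (j + 1)).re| ≤ R ^ m * μ := by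
    calc |(∑ j ∈ range (m + m), t (j + 1)).re| ≤ ‖∑ j ∈ range (m + m), t (j + 1)‖ :=
          Complex.abs_re_le_norm _
      _ ≤ ∑ j ∈ range (m + m), R ^ m * Λ * (x ^ (j + 1) / (j + 1)!) :=
          norm_sum_le_of_le _ fun j _ => hbound (j + 1)
      _ = R ^ m * (Λ * ∑ j ∈ range (m + m), x ^ (j + 1) / (j + 1)!) := by
          rw [← mul_sum, mul_assoc]
      _ ≤ R ^ m * (Λ * (Real.exp x - 1)) := by gcongr
      _ ≤ R ^ m * μ := by gcongr
  have h2 := hμ z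
  have h3 := neg_le_of_abs_le h1
  linarith

theorem fischer_re_nonneg {f G : MvPolynomial (ι ⊕ ι) ℂ} {m N : ℕ} (hN : 0 < N)
    (hf : IsBihomogeneous f m m) {μ Λ : ℝ} (hΛ : 0 ≤ Λ)
    (hfΛ : fischerNormSq f ≤ (m ! * Λ) ^ 2)
    (hμ : ∀ z : ι → ℂ, μ * (∑ i, ‖z i‖ ^ 2) ^ m ≤ (diagEval z f).re)
    (hexp : Λ * (Real.exp (√(Fintype.card ι) * m ^ 2 / N) - 1) ≤ μ)
    (hG : IsBihomogeneous G (m + N) (m + N)) (hG0 : ∀ z : ι → ℂ, 0 ≤ diagEval z G) :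
    0 ≤ (fischer G (normSqPoly ι ^ N * f)).re := by
  rw [fischer_eq_gaussMoment_upperSymbol hN hf hG, ← Complex.ofReal_natCast, Complex.re_ofReal_mul]
  refine mul_nonneg (Nat.cast_nonneg _) (gaussMoment_re_nonneg fun z => ?_)
  obtain ⟨h1, h2⟩ := Complex.nonneg_iff.1 (hG0 z)
  rw [map_mul, Complex.mul_re, ← h2, mul_zero, sub_zero]
  exact mul_nonneg (diagEval_upperSymbol_re_nonneg hN hf hΛ hfΛ hμ hexp z) h1

/-! ### Sums of squares from positivity on rank-one forms -/

section matrix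

open scoped Matrix MatrixOrder Matrix.Norms.L2Operator

/-- If the quadratic form of `H` has nonnegative real part, that real part is a sum of squares of
linear forms. No symmetry of `H` is needed, since only its Hermitian part contributes. -/
theorem exists_gram_of_re_nonneg {I : Type*} [Fintype I] [DecidableEq I] (H : Matrix I I ℂ)
    (hH : ∀ v : I → ℂ, 0 ≤ (star v ⬝ᵥ H *ᵥ v).re) :
    ∃ B : Matrix I I ℂ, ∀ v : I → ℂ, (star v ⬝ᵥ H *ᵥ v).re = ∑ j, ‖(B *ᵥ v) j‖ ^ 2 := by
  set K : Matrix I I ℂ := (1 / 2 : ℂ) • (H + Hᴴ) with hK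
  have hKv : ∀ v : I → ℂ, star v ⬝ᵥ K *ᵥ v = ((star v ⬝ᵥ H *ᵥ v).re : ℂ) := by
    intro v
    have h1 : star v ⬝ᵥ Hᴴ *ᵥ v = conj (star v ⬝ᵥ H *ᵥ v) := by
      rw [← Complex.star_def, ← Matrix.star_dotProduct, Matrix.star_mulVec,
        Matrix.dotProduct_mulVec]
    rw [hK, Matrix.smul_mulVec, Matrix.add_mulVec, dotProduct_smul, dotProduct_add, h1,
      Complex.add_conj]
    simp
  have hpsd : K.PosSemidef := by
    refine Matrix.PosSemidef.of_dotProduct_mulVec_nonneg ?_ fun v => ?_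
    · rw [hK, Matrix.IsHermitian, Matrix.conjTranspose_smul, Matrix.conjTranspose_add,
        Matrix.conjTranspose_conjTranspose, add_comm]
      simp
    · rw [hKv]
      exact_mod_cast hH v
  obtain ⟨B, hB⟩ := CStarAlgebra.nonneg_iff_eq_star_mul_self.mp hpsd.nonneg
  refine ⟨B, fun v => ?_⟩
  have h := hKv v
  rw [hB, Matrix.star_eq_conjTranspose, ← Matrix.mulVec_mulVec, Matrix.dotProduct_mulVec,
    ← Matrix.star_mulVec] at h
  rw [← Complex.ofReal_inj, ← h]
  simp [dotProduct, Complex.conj_mul']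

end matrix

theorem finrank_homogeneousSubmodule (n k : ℕ) :
    Module.finrank ℂ (homogeneousSubmodule (Fin n) ℂ k) = Fintype.card (multiIndices n k) := by
  have hset : {d : Fin n →₀ ℕ | d.degree = k} = (multiIndices n k : Set (Fin n →₀ ℕ)) := by
    ext d
    simp [mem_multiIndices, Finsupp.degree_eq_sum]
  have h : homogeneousSubmodule (Fin n) ℂ k =
      restrictSupport ℂ (multiIndices n k : Set (Fin n →₀ ℕ)) := by
    rw [homogeneousSubmodule_eq_finsupp_supported, hset]; rfl
  rw [h, Module.finrank_eq_card_basis (basisRestrictSupport ℂ _)]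
  rfl

/-! ### Forms as polynomials in `z` and `z̄` -/

variable {n : ℕ}

/-- The form with coefficients `c`, as a polynomial in the independent variables `z` and `z̄`. -/
noncomputable def bihomForm (m : ℕ) (c : (Fin n →₀ ℕ) → (Fin n →₀ ℕ) → ℂ) :
    MvPolynomial (Fin n ⊕ Fin n) ℂ :=
  ∑ α ∈ multiIndices n m, ∑ β ∈ multiIndices n m, monomial (Finsupp.sumElim α β) (c α β)

theorem sumElim_inj {α β α' β' : Fin n →₀ ℕ} :
    Finsupp.sumElim α β = Finsupp.sumElim α' β' ↔ α = α' ∧ β = β' := by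
  rw [← Prod.mk_inj]
  exact Finsupp.sumFinsuppEquivProdFinsupp.symm.injective.eq_iff (a := (α, β)) (b := (α', β'))

theorem exists_sumElim (s : Fin n ⊕ Fin n →₀ ℕ) : ∃ α β, s = Finsupp.sumElim α β :=
  ⟨_, _, (Finsupp.sumFinsuppEquivProdFinsupp.symm_apply_apply s).symm⟩

theorem coeff_bihomForm (m : ℕ) (c : (Fin n →₀ ℕ) → (Fin n →₀ ℕ) → ℂ) (α β : Fin n →₀ ℕ) :
    coeff (Finsupp.sumElim α β) (bihomForm m c) =
      if α ∈ multiIndices n m ∧ β ∈ multiIndices n m then c α β else 0 := by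
  classical
  simp only [bihomForm, coeff_sum, coeff_monomial, sumElim_inj, ite_and, sum_ite_irrel,
    sum_const_zero, sum_ite_eq']

theorem isBihomogeneous_bihomForm (m : ℕ) (c : (Fin n →₀ ℕ) → (Fin n →₀ ℕ) → ℂ) :
    IsBihomogeneous (bihomForm m c) m m := by
  intro s hs
  obtain ⟨α, β, rfl⟩ := exists_sumElim s
  rw [coeff_bihomForm] at hs
  have h := (ite_ne_right_iff.1 hs).1
  rw [mem_multiIndices, mem_multiIndices] at h
  exact h

theorem eq_bihomForm {F : MvPolynomial (Fin n ⊕ Fin n) ℂ} {k : ℕ} (hF : IsBihomogeneous F k k) :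
    F = bihomForm k fun α β => coeff (Finsupp.sumElim α β) F := by
  ext s
  obtain ⟨α, β, rfl⟩ := exists_sumElim s
  rw [coeff_bihomForm]
  split_ifs with h
  · rfl
  · by_contra h'
    refine h ?_
    rw [mem_multiIndices, mem_multiIndices]
    exact hF _ h'

theorem diagEval_bihomForm (m : ℕ) (c : (Fin n →₀ ℕ) → (Fin n →₀ ℕ) → ℂ)
    (z : EuclideanSpace ℂ (Fin n)) : diagEval (fun i => z i) (bihomForm m c) = form m c z := by
  simp only [bihomForm, form, map_sum, diagEval_monomial, monomialAt, map_prod, map_pow,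
    prod_mul_distrib, Finsupp.sumElim_inl, Finsupp.sumElim_inr, mul_assoc]

theorem prod_factorial_sumElim (α β : Fin n →₀ ℕ) :
    ∏ x, (((Finsupp.sumElim α β) x)! : ℂ) = (multiFactorial α : ℂ) * multiFactorial β := by
  simp [Fintype.prod_sum_type, multiFactorial]

theorem fischerNormSq_bihomForm_le (m : ℕ) (c : (Fin n →₀ ℕ) → (Fin n →₀ ℕ) → ℂ) :
    fischerNormSq (bihomForm m c) ≤ (m ! * coeffNorm m c) ^ 2 := by
  classical
  have hfac : (m ! : ℝ) ≠ 0 := by exact_mod_cast m.factorial_ne_zero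
  set T := (multiIndices n m ×ˢ multiIndices n m).map
    Finsupp.sumFinsuppEquivProdFinsupp.symm.toEmbedding with hT
  have hsub : (bihomForm m c).support ⊆ T := by
    intro s hs
    obtain ⟨α, β, rfl⟩ := exists_sumElim s
    rw [mem_support_iff, coeff_bihomForm] at hs
    exact mem_map.2 ⟨(α, β), mem_product.2 (ite_ne_right_iff.1 hs).1, rfl⟩
  have h1 : fischerNormSq (bihomForm m c) ≤
      ∑ s ∈ T, (∏ x, ((s x)! : ℝ)) * ‖coeff s (bihomForm m c)‖ ^ 2 :=
    sum_le_sum_of_subset_of_nonneg hsub fun _ _ _ => by positivity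
  refine h1.trans (le_of_eq ?_)
  rw [hT, sum_map, sum_product, mul_pow, coeffNorm, Real.sq_sqrt, mul_sum]
  · refine sum_congr rfl fun α hα => ?_
    rw [mul_sum]
    refine sum_congr rfl fun β hβ => ?_
    have h2 : Finsupp.sumFinsuppEquivProdFinsupp.symm.toEmbedding (α, β) =
      Finsupp.sumElim α β := rfl
    rw [h2, coeff_bihomForm, if_pos ⟨hα, hβ⟩]
    simp [Fintype.prod_sum_type, multiFactorial]
    field_simp
  · exact sum_nonneg fun _ _ => sum_nonneg fun _ _ => by positivity

theorem fischer_bihomForm (k : ℕ) (g h : (Fin n →₀ ℕ) → (Fin n →₀ ℕ) → ℂ) :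
    fischer (bihomForm k g) (bihomForm k h) =
      ∑ α ∈ multiIndices n k, ∑ β ∈ multiIndices n k,
        h α β * (multiFactorial α * multiFactorial β * g β α) := by
  conv_lhs => rw [bihomForm.eq_def k h]
  simp only [map_sum]
  refine sum_congr rfl fun α hα => sum_congr rfl fun β hβ => ?_
  rw [show monomial (Finsupp.sumElim α β) (h α β) = h α β • monomial (Finsupp.sumElim α β) 1 by
    rw [smul_monomial]; simp, map_smul, fischer_monomial, Finsupp.mapDomain_swap_sumElim,
    coeff_bihomForm, if_pos ⟨hβ, hα⟩, prod_factorial_sumElim, smul_eq_mul]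

theorem form_rankOne (k : ℕ) (v : (Fin n →₀ ℕ) → ℂ) (z : EuclideanSpace ℂ (Fin n)) :
    form k (fun α β => v α * conj (v β)) z =
      ((‖∑ α ∈ multiIndices n k, v α * monomialAt z α‖ ^ 2 : ℝ) : ℂ) := by
  rw [Complex.ofReal_pow, ← Complex.mul_conj', map_sum, sum_mul_sum, form]
  refine sum_congr rfl fun α _ => sum_congr rfl fun β _ => ?_
  rw [map_mul]; ring

/-- Duality between squares and the Fischer pairing: if `F` pairs nonnegatively with every `G` that is
nonnegative on the diagonal (rank-one forms `|q|²` suffice), its coefficient matrix has positive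
semidefinite Hermitian part, and hence the real part of `F` is a sum of squares. -/
theorem exists_sum_norm_sq_of_fischer_re_nonneg {F : MvPolynomial (Fin n ⊕ Fin n) ℂ} {k : ℕ}
    (hF : IsBihomogeneous F k k)
    (hpos : ∀ G : MvPolynomial (Fin n ⊕ Fin n) ℂ, IsBihomogeneous G k k →
      (∀ z : Fin n → ℂ, 0 ≤ diagEval z G) → 0 ≤ (fischer G F).re) :
    ∃ P : Fin (Module.finrank ℂ (homogeneousSubmodule (Fin n) ℂ k)) → MvPolynomial (Fin n) ℂ,
      (∀ j, (P j).IsHomogeneous k) ∧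
      ∀ z : EuclideanSpace ℂ (Fin n), (diagEval (fun i => z i) F).re =
        ∑ j, ‖eval (fun i => z i) (P j)‖ ^ 2 := by
  classical
  set A := multiIndices n k with hA
  set h : (Fin n →₀ ℕ) → (Fin n →₀ ℕ) → ℂ := fun α β => coeff (Finsupp.sumElim α β) F with hh
  have hFh : F = bihomForm k h := eq_bihomForm hF
  set H : Matrix A A ℂ := Matrix.of fun α β => h α β with hH
  have hquad : ∀ v : A → ℂ, star v ⬝ᵥ H.mulVec v =
      ∑ α : A, ∑ β : A, h α β * (conj (v α) * v β) := by
    intro v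
    simp only [dotProduct, Matrix.mulVec, mul_sum]
    refine sum_congr rfl fun α _ => sum_congr rfl fun β _ => ?_
    simp [hH]; ring
  obtain ⟨B, hB⟩ := exists_gram_of_re_nonneg H fun v => by
    -- The factorials in the Fischer pairing are compensated by those in `w`.
    set w : (Fin n →₀ ℕ) → ℂ := fun α =>
      if hα : α ∈ A then v ⟨α, hα⟩ / multiFactorial α else 0 with hw
    have h1 := hpos (bihomForm k fun α β => w α * conj (w β)) (isBihomogeneous_bihomForm _ _)
      fun z => by
        have := diagEval_bihomForm k (fun α β => w α * conj (w β)) (WithLp.toLp 2 z)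
        rw [form_rankOne] at this
        simp only at this
        rw [this]
        exact Complex.zero_le_real.2 (sq_nonneg _)
    rw [hFh, fischer_bihomForm] at h1
    convert h1 using 2
    rw [hquad, ← hA, ← sum_coe_sort A]
    refine sum_congr rfl fun α _ => ?_
    rw [← sum_coe_sort A]
    refine sum_congr rfl fun β _ => ?_
    have hfac : ∀ γ : Fin n →₀ ℕ, (multiFactorial γ : ℂ) ≠ 0 := fun γ =>
      Nat.cast_ne_zero.2 (prod_ne_zero_iff.2 fun i _ => Nat.factorial_ne_zero _)
    have h2 := hfac α
    have h3 := hfac β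
    simp only [hw, α.2, β.2, dif_pos, Subtype.coe_eta, map_div₀, Complex.conj_natCast]
    field_simp
  have e : Fin (Module.finrank ℂ (homogeneousSubmodule (Fin n) ℂ k)) ≃ A :=
    (finCongr (finrank_homogeneousSubmodule n k)).trans (Fintype.equivFin A).symm
  refine ⟨fun j => ∑ α : A, monomial (α : Fin n →₀ ℕ) (conj (B (e j) α)), fun j => ?_, fun z => ?_⟩
  · refine IsHomogeneous.sum _ _ _ fun α _ => isHomogeneous_monomial _ ?_
    rw [Finsupp.degree_eq_sum]
    exact mem_multiIndices.1 α.2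
  · have h1 : diagEval (fun i => z i) F =
        star (fun α : A => conj (monomialAt z α)) ⬝ᵥ
          H.mulVec (fun α : A => conj (monomialAt z α)) := by
      rw [hquad, hFh, diagEval_bihomForm, form, ← hA, ← sum_coe_sort A]
      refine sum_congr rfl fun α _ => ?_
      rw [← sum_coe_sort A]
      refine sum_congr rfl fun β _ => ?_
      rw [Complex.conj_conj]; ring
    rw [h1, hB, ← e.sum_comp]
    refine sum_congr rfl fun j _ => ?_
    rw [← RCLike.norm_conj, Matrix.mulVec, dotProduct, map_sum, map_sum]
    congr 2
    refine sum_congr rfl fun α _ => ?_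
    rw [eval_monomial, Finsupp.prod_fintype _ _ (by simp)]
    simp [monomialAt]

/-! ### The extremal constants of a form, and the quantitative bound -/

theorem norm_form_le (m : ℕ) (c : (Fin n →₀ ℕ) → (Fin n →₀ ℕ) → ℂ)
    (z : EuclideanSpace ℂ (Fin n)) :
    ‖form m c z‖ ≤ coeffNorm m c * (‖z‖ ^ 2) ^ m := by
  have h0 : 0 ≤ coeffNorm m c := Real.sqrt_nonneg _
  have h := norm_diagEval_mixedLaplacian_pow_le (isBihomogeneous_bihomForm m c)
    h0 (fischerNormSq_bihomForm_le m c) (Nat.zero_le m)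
    (fun i => z i)
  simpa [diagEval_bihomForm, EuclideanSpace.norm_sq_eq] using h

theorem form_smul (m : ℕ) (c : (Fin n →₀ ℕ) → (Fin n →₀ ℕ) → ℂ) (r : ℝ)
    (z : EuclideanSpace ℂ (Fin n)) :
    form m c ((r : ℂ) • z) = ((r ^ 2) ^ m : ℝ) * form m c z := by
  have h : ∀ α ∈ multiIndices n m, monomialAt ((r : ℂ) • z) α = (r : ℂ) ^ m * monomialAt z α := by
    intro α hα
    rw [← mem_multiIndices.1 hα]
    simp [monomialAt, mul_pow, prod_mul_distrib, prod_pow_eq_pow_sum]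
  rw [form, form, mul_sum]
  refine sum_congr rfl fun α hα => ?_
  rw [mul_sum]
  refine sum_congr rfl fun β hβ => ?_
  rw [h α hα, h β hβ]
  simp
  ring

/-- At `z = 0` both sides vanish, because `m ≠ 0`. -/
theorem minOnSphere_mul_le_re_form (hn : 0 < n) {m : ℕ} (hm : m ≠ 0)
    (c : (Fin n →₀ ℕ) → (Fin n →₀ ℕ) → ℂ) (z : EuclideanSpace ℂ (Fin n)) :
    minOnSphere m c * (‖z‖ ^ 2) ^ m ≤ (form m c z).re := by
  rcases eq_or_ne z 0 with rfl | hz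
  · have h := norm_form_le m c (0 : EuclideanSpace ℂ (Fin n))
    simp [hm] at h
    simp [h, hm]
  · have hz' : ‖z‖ ≠ 0 := norm_ne_zero_iff.2 hz
    have h1 : minOnSphere m c ≤ (form m c (((‖z‖⁻¹ : ℝ) : ℂ) • z)).re := by
      refine (isLeast_minOnSphere hn m c).2 ⟨_, ?_, rfl⟩
      rw [mem_sphere_zero_iff_norm, norm_smul, Complex.norm_real, norm_inv, norm_norm,
        inv_mul_cancel₀ hz']
    rw [form_smul, Complex.re_ofReal_mul, inv_pow, inv_pow] at h1
    have h2 : 0 < (‖z‖ ^ 2) ^ m := by positivity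
    rw [inv_mul_eq_div, le_div_iff₀ h2] at h1
    exact h1

theorem minOnSphere_pos (hn : 0 < n) (m : ℕ) (c : (Fin n →₀ ℕ) → (Fin n →₀ ℕ) → ℂ)
    (hc : ∀ z : EuclideanSpace ℂ (Fin n), z ≠ 0 → 0 < form m c z) : 0 < minOnSphere m c := by
  obtain ⟨z, hz, h⟩ := (isLeast_minOnSphere hn m c).1
  rw [← h]
  exact (Complex.pos_iff.1 (hc z (ne_zero_of_mem_unit_sphere ⟨z, hz⟩))).1

theorem minOnSphere_le_coeffNorm (hn : 0 < n) (m : ℕ) (c : (Fin n →₀ ℕ) → (Fin n →₀ ℕ) → ℂ) :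
    minOnSphere m c ≤ coeffNorm m c := by
  obtain ⟨z, hz, h⟩ := (isLeast_minOnSphere hn m c).1
  rw [← h]
  have h1 := norm_form_le m c z
  rw [mem_sphere_zero_iff_norm.1 hz] at h1
  simpa using (Complex.re_le_norm _).trans h1

theorem form_mul_norm_pow (m N : ℕ) (c : (Fin n →₀ ℕ) → (Fin n →₀ ℕ) → ℂ)
    (z : EuclideanSpace ℂ (Fin n)) :
    diagEval (fun i => z i) (normSqPoly (Fin n) ^ N * bihomForm m c) =
      ((‖z‖ ^ (2 * N) : ℝ) : ℂ) * form m c z := by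
  rw [map_mul, map_pow, diagEval_normSqPoly, diagEval_bihomForm, pow_mul,
    EuclideanSpace.norm_sq_eq, Complex.ofReal_pow]

/-- Sharper form of the result, with threshold `2 (Λ/λ) √n m²`. -/
theorem exists_sum_norm_sq_of_sqrt_mul_le (hn : 0 < n) {m N : ℕ} (hm : m ≠ 0)
    (c : (Fin n →₀ ℕ) → (Fin n →₀ ℕ) → ℂ)
    (hc : ∀ z : EuclideanSpace ℂ (Fin n), z ≠ 0 → 0 < form m c z)
    (hN : 2 * (coeffNorm m c / minOnSphere m c) * (√n * m ^ 2) ≤ N) :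
    ∃ P : Fin (Module.finrank ℂ (homogeneousSubmodule (Fin n) ℂ (m + N))) →
        MvPolynomial (Fin n) ℂ,
      (∀ j, (P j).IsHomogeneous (m + N)) ∧
      ∀ z : EuclideanSpace ℂ (Fin n),
        ((‖z‖ ^ (2 * N) : ℝ) : ℂ) * form m c z =
          ((∑ j, ‖eval (fun i => z i) (P j)‖ ^ 2 : ℝ) : ℂ) := by
  set μ := minOnSphere m c with hμ
  set Λ := coeffNorm m c with hΛ
  have hμ0 : 0 < μ := minOnSphere_pos hn m c hc
  have hμΛ : μ ≤ Λ := minOnSphere_le_coeffNorm hn m c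
  have hΛ0 : 0 < Λ := hμ0.trans_le hμΛ
  have hy : 0 < √n * (m : ℝ) ^ 2 := by positivity
  have hN0 : (0 : ℝ) < N := lt_of_lt_of_le (by positivity) hN
  have hexp : Λ * (Real.exp (√(Fintype.card (Fin n)) * m ^ 2 / N) - 1) ≤ μ := by
    rw [Fintype.card_fin]
    set x : ℝ := √n * m ^ 2 / N with hx
    have hx0 : 0 ≤ x := by positivity
    have hxΛ : 2 * Λ * x ≤ μ := by
      rw [hx, mul_div_assoc', div_le_iff₀ hN0]
      calc 2 * Λ * (√n * m ^ 2) = μ * (2 * (Λ / μ) * (√n * m ^ 2)) := by field_simp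
        _ ≤ μ * N := by gcongr
    -- `x ≤ μ / (2 Λ) ≤ 1 / 2`, so that `eˣ - 1 ≤ 2 x`.
    have hx1 : |x| ≤ 1 := by
      rw [abs_of_nonneg hx0]
      by_contra! h
      nlinarith
    have h := (le_abs_self _).trans (Real.abs_exp_sub_one_le hx1)
    rw [abs_of_nonneg hx0] at h
    calc Λ * (Real.exp x - 1) ≤ Λ * (2 * x) := by gcongr
      _ ≤ μ := by linarith
  have hF : IsBihomogeneous (normSqPoly (Fin n) ^ N * bihomForm m c) (m + N) (m + N) := by
    rw [add_comm m N]
    exact (IsBihomogeneous.normSqPoly_pow N).mul (isBihomogeneous_bihomForm m c)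
  obtain ⟨P, hP, hPz⟩ := exists_sum_norm_sq_of_fischer_re_nonneg hF fun G hG hG0 =>
    fischer_re_nonneg (by exact_mod_cast hN0) (isBihomogeneous_bihomForm m c) hΛ0.le
      (fischerNormSq_bihomForm_le m c) (fun z => by
        have h := minOnSphere_mul_le_re_form hn hm c (WithLp.toLp 2 z)
        rw [EuclideanSpace.norm_sq_eq, ← diagEval_bihomForm] at h
        exact h) hexp hG hG0
  refine ⟨P, hP, fun z => ?_⟩
  have hreal : (form m c z).im = 0 := by
    rcases eq_or_ne z 0 with rfl | hz
    · have h := norm_form_le m c (0 : EuclideanSpace ℂ (Fin n))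
      simp [hm] at h
      simp [h]
    · exact (Complex.pos_iff.1 (hc z hz)).2.symm
  rw [← hPz, form_mul_norm_pow]
  apply Complex.ext
  · simp
  · rw [Complex.im_ofReal_mul, hreal]; simp

end HermitianSOS

theorem theorem2 :
    ∃ C : ℝ, 0 < C ∧
      ∀ (n m : ℕ), 2 ≤ n → 1 ≤ m →
      ∀ c : (Fin n →₀ ℕ) → (Fin n →₀ ℕ) → ℂ,
      (∀ z : EuclideanSpace ℂ (Fin n), z ≠ 0 → 0 < HermitianSOS.form m c z) →
      ∀ N : ℕ,
      C * (HermitianSOS.coeffNorm m c / HermitianSOS.minOnSphere m c)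
          * ((m : ℝ) + (n : ℝ)) ^ 3 * Real.log (n : ℝ) ^ 3 ≤ (N : ℝ) →
      ∃ P : Fin (Module.finrank ℂ (MvPolynomial.homogeneousSubmodule (Fin n) ℂ (m + N))) →
          MvPolynomial (Fin n) ℂ,
        (∀ j, (P j).IsHomogeneous (m + N)) ∧
        ∀ z : EuclideanSpace ℂ (Fin n),
          ((‖z‖ ^ (2 * N) : ℝ) : ℂ) * HermitianSOS.form m c z
            = ((∑ j, ‖MvPolynomial.eval (fun i => z i) (P j)‖ ^ 2 : ℝ) : ℂ) := by
  refine ⟨16, by norm_num, fun n m hn hm c hc N hN => ?_⟩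
  refine HermitianSOS.exists_sum_norm_sq_of_sqrt_mul_le (by omega) (by omega) c hc
    (le_trans ?_ hN)
  have hn' : (2 : ℝ) ≤ n := by exact_mod_cast hn
  have hm' : (1 : ℝ) ≤ m := by exact_mod_cast hm
  have hratio : 0 ≤ HermitianSOS.coeffNorm m c / HermitianSOS.minOnSphere m c :=
    div_nonneg (Real.sqrt_nonneg _) (HermitianSOS.minOnSphere_pos (by omega) m c hc).le
  have hlog : 1 / 2 ≤ Real.log n := by
    have h1 := Real.log_le_log (by norm_num) hn'
    have h2 := Real.log_two_gt_d9
    linarith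
  have hlog3 : (1 / 2 : ℝ) ^ 3 ≤ Real.log n ^ 3 := by gcongr
  have hsqrt : √(n : ℝ) ≤ m + n := by
    rw [Real.sqrt_le_left (by positivity)]
    nlinarith
  have hcube : √(n : ℝ) * m ^ 2 ≤ ((m : ℝ) + n) ^ 3 := by
    calc √(n : ℝ) * m ^ 2 ≤ (m + n) * (m + n) ^ 2 := by gcongr; linarith
      _ = _ := by ring
  calc 2 * (HermitianSOS.coeffNorm m c / HermitianSOS.minOnSphere m c) * (√(n : ℝ) * m ^ 2)
      ≤ 2 * (HermitianSOS.coeffNorm m c / HermitianSOS.minOnSphere m c) * ((m : ℝ) + n) ^ 3 := by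
        gcongr
    _ = 16 * (HermitianSOS.coeffNorm m c / HermitianSOS.minOnSphere m c) * ((m : ℝ) + n) ^ 3 *
          (1 / 2) ^ 3 := by ring
    _ ≤ _ := by gcongr
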